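/- Let $x=(x(n))_{n\ge 0}\in\{0,1\}^{\mathbb N}$ be the Thue--Morse sequence ($x(n)$ is the parity of the number of $1$s in the binary expansion of $n$) and put $m_n=(-1)^{x(n)}$. For a measure $\rho$ on the unit circle $\mathbb S^1$ and an integer $r\ge 0$ let $\rho^{(r)}$ denote the image of $\rho$ under $z\mapsto z^r$; $\mathbb N$ includes $0$. There is a unique finite Borel measure $\sigma$ on $\mathbb S^1$ (the spectral measure of the Thue--Morse sequence) with $$\int_{\mathbb S^1} z^k\,d\sigma(z)=\lim_{N\to\infty}\frac1N\sum_{n=1}^N m_{n+k}m_n\qquad(k\ge 0),$$ all these limits existing. It satisfies: (1) for all integers $r,s\ge 1$: $\sigma^{(r)}\perp\sigma^{(s)}$ if and only if $\max\{r/s,s/r\}\notin\{2^a: a\in\mathbb N\}$; (2) $\sigma^{(r)}=\sigma^{(2^a r)}$ for all integers $a,r\ge 0$; (3) in particular $\sigma^{(p)}\perp\sigma^{(q)}$ for all odd natural numbers $p\ne q$. Let $X\subset\{0,1\}^{\mathbb Z}$ be the set of two-sided sequences all of whose finite blocks of consecutive symbols appear in $x$, and let $T$ be the left shift. There exists a $T$-invariant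 Borel probability measure on $X$; let $\mu$ be any such measure. For $F\in L^2(\mu)$ the spectral measure $\sigma_F$ is the finite measure on $\mathbb S^1$ with $\int z^m\,d\sigma_F=\langle F\circ T^m,F\rangle$ for all $m\in\mathbb Z$, and a finite measure $\tau$ on $\mathbb S^1$ is said to represent the maximal spectral type of $(X,T,\mu)$ if it dominates (in the sense of $\ll$) all the $\sigma_F$ and is absolutely continuous with respect to every other finite measure that dominates them. Then: (4) for every finite discrete measure $D$ whose atoms are exactly the roots of unity of degree $2^n$, $n\ge 0$, the measure $D+D*\sigma$ represents the maximal spectral type of $(X,T,\mu)$, and its continuous (atomless) part is $D*\sigma$; (5) if $\tau$ represents the maximal spectral type of $(X,T,\mu)$ and $\widetilde\sigma$ is the continuous part of $\tau$, then (1) and (3) hold with $\widetilde\sigma$ in place of $\sigma$, and (2) holds for $\widetilde\sigma$ up to type: $\widetilde\sigma^{(r)}$ and $\widetilde\sigma^{(2^a r)}$ are mutually absolutely continuous for all integers $a,r\ge 0$. -/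

import Mathlib

open MeasureTheory Filter Topology

namespace ThueMorse

/-- The Thue-Morse sequence `01 × 01 × ⋯` with `0 = false` and `1 = true`: the parity of the
number of ones in the binary expansion of `n`. -/
def seq (n : ℕ) : Bool := decide ((Nat.digits 2 n).sum % 2 = 1)

theorem seq_zero : seq 0 = false := by simp [seq]

theorem seq_two_mul (n : ℕ) : seq (2 * n) = seq n := by
  rcases Nat.eq_zero_or_pos n with rfl | h
  · rfl
  · unfold seq
    rw [Nat.digits_def' (by norm_num) (by omega)]
    simp

theorem seq_two_mul_add_one (n : ℕ) : seq (2 * n + 1) = !seq n := by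
  unfold seq
  rw [Nat.digits_def' (by norm_num) (by omega)]
  have h1 : (2 * n + 1) % 2 = 1 := by omega
  have h2 : (2 * n + 1) / 2 = n := by omega
  rw [h1, h2, List.sum_cons]
  by_cases h : (Nat.digits 2 n).sum % 2 = 1
  · simp [h]; omega
  · simp [h]; omega

/-- The block of length `2 ^ (k + 1)` of the sequence is the block of length `2 ^ k` followed by
its complement. -/
theorem seq_two_pow_add (k j : ℕ) (hj : j < 2 ^ k) : seq (2 ^ k + j) = !seq j := by
  induction k generalizing j with
  | zero =>
    obtain rfl : j = 0 := by simpa using hj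
    simpa using seq_two_mul_add_one 0
  | succ k ih =>
    rw [pow_succ] at hj
    rcases Nat.even_or_odd' j with ⟨i, rfl | rfl⟩
    · rw [show 2 ^ (k + 1) + 2 * i = 2 * (2 ^ k + i) by ring, seq_two_mul, seq_two_mul,
        ih i (by omega)]
    · rw [show 2 ^ (k + 1) + (2 * i + 1) = 2 * (2 ^ k + i) + 1 by ring, seq_two_mul_add_one,
        seq_two_mul_add_one, ih i (by omega)]

/-- The circle carries its Borel σ-algebra. -/
noncomputable instance circleMeasurableSpace : MeasurableSpace Circle := borel Circle

instance circleBorelSpace : BorelSpace Circle := ⟨rfl⟩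

/-- The `±1`-valued sequence `m_n = (-1)^{x(n)}`. -/
noncomputable def sign (n : ℕ) : ℂ := if seq n then -1 else 1

/-- `σ` is the spectral measure of the Thue-Morse sequence: a finite Borel measure on the circle
such that, for each `k ≥ 0`, the correlation
`lim_N (1/N) ∑_{n=1}^N m_{n+k} m_n` exists and equals `∫ z^k dσ`. (The coefficients with `k < 0`
are the complex conjugates of these.) -/
structure IsSpectralMeasureOfSeq (σ : Measure Circle) : Prop where
  finite : IsFiniteMeasure σ
  tendsto : ∀ k : ℕ, Tendsto
    (fun N : ℕ => (1 / (N : ℂ)) * ∑ n ∈ Finset.Icc 1 N, sign (n + k) * sign n)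
    atTop (𝓝 (∫ z : Circle, (z : ℂ) ^ k ∂σ))

/-- The `r`-th power image `ρ^(r)` of a measure `ρ` on the circle, its image under `z ↦ z^r`. -/
noncomputable def powImage (ρ : Measure Circle) (r : ℕ) : Measure Circle :=
  ρ.map (fun z => z ^ r)

/-- The iterate `T^m`, `m ∈ ℤ`, of the left shift `T` on two-sided 0-1 sequences. -/
def shift (m : ℤ) (y : ℤ → Bool) : ℤ → Bool := fun i => y (i + m)

theorem shift_zero (y : ℤ → Bool) : shift 0 y = y := by
  funext i; simp [shift]

theorem shift_add (m n : ℤ) (y : ℤ → Bool) : shift (m + n) y = shift m (shift n y) := by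
  funext i; simp [shift, add_assoc]

/-- The Thue-Morse subshift: the two-sided sequences all of whose finite blocks of consecutive
symbols appear in the Thue-Morse sequence. -/
def subshift : Set (ℤ → Bool) :=
  {y | ∀ (i : ℤ) (n : ℕ), ∃ j : ℕ, ∀ l < n, y (i + (l : ℤ)) = seq (j + l)}

/-- `μ` is a shift-invariant Borel probability measure on the Thue-Morse subshift (regarded as a
measure on the full two-sided shift space that is carried by the subshift). -/
structure IsSubshiftMeasure (μ : Measure (ℤ → Bool)) : Prop where
  prob : IsProbabilityMeasure μ
  invariant : MeasurePreserving (shift 1) μ μ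
  carried : ∀ᵐ y ∂μ, y ∈ subshift

/-- `ρ` is the spectral measure of `F ∈ L²(μ)` for the unitary operator `U F = F ∘ T`: a finite
Borel measure on the circle with `∫ z^m dρ = ⟨U^m F, F⟩` for all integers `m`. -/
structure IsSpectralMeasureOf (μ : Measure (ℤ → Bool)) (F : (ℤ → Bool) → ℂ)
    (ρ : Measure Circle) : Prop where
  finite : IsFiniteMeasure ρ
  fourier : ∀ m : ℤ, ∫ z : Circle, (z : ℂ) ^ m ∂ρ =
    ∫ y, F (shift m y) * (starRingEnd ℂ) (F y) ∂μ

/-- Every spectral measure of an `L²(μ)` function is absolutely continuous with respect to `τ`. -/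
def DominatesSpectralMeasures (μ : Measure (ℤ → Bool)) (τ : Measure Circle) : Prop :=
  ∀ (F : (ℤ → Bool) → ℂ) (ρ : Measure Circle), MemLp F 2 μ → IsSpectralMeasureOf μ F ρ → ρ ≪ τ

/-- `τ` represents the maximal spectral type of the shift on `L²(μ)`: it is a finite measure that
dominates all spectral measures, and it is the least such measure with respect to `≪`. -/
structure IsMaximalSpectralType (μ : Measure (ℤ → Bool)) (τ : Measure Circle) : Prop where
  finite : IsFiniteMeasure τ
  dominates : DominatesSpectralMeasures μ τ
  least : ∀ τ' : Measure Circle, IsFiniteMeasure τ' → DominatesSpectralMeasures μ τ' → τ ≪ τ'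

/-- The continuous (atomless) part of a finite measure on the circle. -/
noncomputable def continuousPart (τ : Measure Circle) : Measure Circle :=
  τ.restrict {z | τ {z} = 0}

/-- The roots of unity of degree `2^n`, `n ≥ 0`. -/
def dyadicRoots : Set Circle := {z | ∃ n : ℕ, z ^ (2 ^ n) = 1}

/-- A finite discrete measure whose atoms are exactly the roots of unity of degree `2^n`,
`n ≥ 0`. -/
structure IsDyadicDiscrete (D : Measure Circle) : Prop where
  finite : IsFiniteMeasure D
  carried : D dyadicRootsᶜ = 0
  atoms : ∀ z ∈ dyadicRoots, D {z} ≠ 0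

/-- Two measures have the same type: they are mutually absolutely continuous. -/
def SameType (ρ ρ' : Measure Circle) : Prop := ρ ≪ ρ' ∧ ρ' ≪ ρ

end ThueMorse

namespace ThueMorse

/-! ### Correlations of the Thue-Morse sequence -/

/-! Splitting sums by parity turns the Thue-Morse recursion into recursions for the correlations:
η(2k) = η(k) and η(2k+1) = -(η(k) + η(k+1))/2, with logarithmic error, uniformly over all windows of
the sequence (`exists_abs_corrErr_le_log`). The operator `lift` acts on moments by the same
recursions, so its iterates from the point mass at 1 converge weakly to σ. The even recursion says
that σ is invariant under squaring; both together say that σ has density `weight` against its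
symmetrization, and this excludes atoms.

The same recursions give mixing of squaring on characters: η(2^n a + b) → η(a) η(b). Hence averages
of z^(k 2^j) over j converge in mean square to η(pk) for σ^(p). The 2-adic valuation of η at an odd
k > 8 reveals the binary length of k (`eta_dyadic`), so for odd p ≠ q some k has η(pk) ≠ η(qk).
Along a common subsequence the averages then converge to different constants almost everywhere, and
σ^(p) ⊥ σ^(q). Arbitrary exponents reduce to their odd parts.

For the subshift, almost every point has at each level n a well-defined phase modulo 2^n in its
division into blocks of length 2^n. The phases give eigenfunctions for every dyadic root ζ, with
spectral measure the point mass at ζ. Multiplied by the sign at coordinate 0, they have the rotate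
of σ by ζ as spectral measure. These functions are total in L², because blocks containing 0 exhaust
ℤ almost surely (`span_generators_topologicalClosure`), and null closed sets pass from a total set
to all vectors (`measure_eq_zero_of_total`). So D + D*σ has the maximal type. Invariance and
singularity pass from σ to D*σ, since iterated squaring kills every dyadic root. -/

/-- The real version of `sign`. -/
def sgn (n : ℕ) : ℝ := if seq n then -1 else 1

theorem sgn_two_mul (n : ℕ) : sgn (2 * n) = sgn n := by simp [sgn, seq_two_mul]

theorem sgn_two_mul_add_one (n : ℕ) : sgn (2 * n + 1) = -sgn n := by
  cases h : seq n <;> simp [sgn, seq_two_mul_add_one, h]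

theorem abs_sgn (n : ℕ) : |sgn n| = 1 := by
  unfold sgn; split_ifs <;> simp

theorem sgn_mul_self (n : ℕ) : sgn n * sgn n = 1 := by
  unfold sgn; split_ifs <;> simp

theorem sign_eq (n : ℕ) : sign n = (sgn n : ℂ) := by
  unfold sign sgn; split_ifs <;> simp

/-- The correlation coefficients of the Thue-Morse sequence. -/
noncomputable def eta : ℕ → ℝ
  | 0 => 1
  -- At k = 0 the odd recursion refers to itself, η(1) = -(1 + η(1))/2; this is its solution.
  | 1 => -1 / 3
  | n + 2 =>
    if _h : n % 2 = 0 then eta ((n + 2) / 2)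
    else -(eta ((n + 2) / 2) + eta ((n + 2) / 2 + 1)) / 2

theorem eta_zero : eta 0 = 1 := by rw [eta]

theorem eta_one : eta 1 = -1 / 3 := by rw [eta]

theorem eta_two_mul (k : ℕ) : eta (2 * k) = eta k := by
  rcases k with _ | k
  · rfl
  · rw [show 2 * (k + 1) = 2 * k + 2 by ring, eta, dif_pos (by omega)]
    congr 1; omega

theorem eta_two_mul_add_one (k : ℕ) : eta (2 * k + 1) = -(eta k + eta (k + 1)) / 2 := by
  rcases k with _ | k
  · norm_num [eta_zero, eta_one]
  · rw [show 2 * (k + 1) + 1 = (2 * k + 1) + 2 by ring, eta, dif_neg (by omega)]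
    rw [show (2 * k + 1 + 2) / 2 = k + 1 by omega]

theorem abs_eta_le (k : ℕ) : |eta k| ≤ 1 := by
  induction k using Nat.strong_induction_on with
  | _ k ih =>
    rcases Nat.even_or_odd' k with ⟨m, rfl | rfl⟩
    · rcases Nat.eq_zero_or_pos m with rfl | hm
      · simp [eta_zero]
      · rw [eta_two_mul]; exact ih m (by omega)
    · rcases Nat.eq_zero_or_pos m with rfl | hm
      · simp [eta_one, abs_le]; norm_num
      · rw [eta_two_mul_add_one]
        have h1 := abs_le.1 (ih m (by omega))
        have h2 := abs_le.1 (ih (m + 1) (by omega))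
        exact abs_le.2 ⟨by linarith, by linarith⟩

/-- Partial sums of the correlation with lag `k`. -/
def corrSum (k n : ℕ) : ℝ := ∑ i ∈ Finset.range n, sgn (i + k) * sgn i

theorem corrSum_succ (k n : ℕ) : corrSum k (n + 1) = corrSum k n + sgn (n + k) * sgn n :=
  Finset.sum_range_succ _ _

theorem abs_corrSum_add_sub_le (k n m : ℕ) : |corrSum k (n + m) - corrSum k n| ≤ m := by
  induction m with
  | zero => simp
  | succ m ih =>
    rw [← add_assoc, corrSum_succ]
    have : |sgn (n + m + k) * sgn (n + m)| = 1 := by rw [abs_mul, abs_sgn, abs_sgn, one_mul]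
    calc |corrSum k (n + m) + sgn (n + m + k) * sgn (n + m) - corrSum k n|
        = |(corrSum k (n + m) - corrSum k n) + sgn (n + m + k) * sgn (n + m)| := by ring_nf
      _ ≤ _ := (abs_add_le _ _).trans (by push_cast; linarith)

theorem corrSum_zero_left (n : ℕ) : corrSum 0 n = n := by
  simp [corrSum, sgn_mul_self]

theorem corrSum_two_mul (k n : ℕ) : corrSum (2 * k) (2 * n) = 2 * corrSum k n := by
  induction n with
  | zero => simp [corrSum]
  | succ n ih =>
    rw [show 2 * (n + 1) = 2 * n + 1 + 1 by ring, corrSum_succ, corrSum_succ, ih, corrSum_succ,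
      show 2 * n + 1 + 2 * k = 2 * (n + k) + 1 by ring, show 2 * n + 2 * k = 2 * (n + k) by ring,
      sgn_two_mul, sgn_two_mul, sgn_two_mul_add_one, sgn_two_mul_add_one]
    ring

theorem corrSum_two_mul_add_one (k n : ℕ) :
    corrSum (2 * k + 1) (2 * n) = -(corrSum k n + corrSum (k + 1) n) := by
  induction n with
  | zero => simp [corrSum]
  | succ n ih =>
    rw [show 2 * (n + 1) = 2 * n + 1 + 1 by ring, corrSum_succ, corrSum_succ, ih, corrSum_succ,
      corrSum_succ,
      show 2 * n + 1 + (2 * k + 1) = 2 * (n + (k + 1)) by ring,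
      show 2 * n + (2 * k + 1) = 2 * (n + k) + 1 by ring,
      sgn_two_mul, sgn_two_mul, sgn_two_mul_add_one, sgn_two_mul_add_one]
    ring

/-- Error of the correlation sum over the window `[j, j + N)`. -/
noncomputable def corrErr (k j N : ℕ) : ℝ := corrSum k (j + N) - corrSum k j - N * eta k

theorem abs_corrErr_le (k j N : ℕ) : |corrErr k j N| ≤ 2 * N := by
  have h1 := abs_le.1 (abs_corrSum_add_sub_le k j N)
  have h2 := abs_le.1 (abs_eta_le k)
  have hN : (0 : ℝ) ≤ N := Nat.cast_nonneg N
  unfold corrErr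
  exact abs_le.2 ⟨by nlinarith, by nlinarith⟩

/-- Rounding start and length down to even numbers moves the left end by at most 1, the right end by
at most 2, and N·η(k) by at most 1. -/
theorem abs_corrErr_sub_le (k j N : ℕ) :
    |corrErr k j N - corrErr k (2 * (j / 2)) (2 * (N / 2))| ≤ 4 := by
  obtain ⟨a, ha, ha'⟩ : ∃ a, j = 2 * (j / 2) + a ∧ a ≤ 1 := ⟨j % 2, by omega, by omega⟩
  obtain ⟨b, hb, hb'⟩ : ∃ b, N = 2 * (N / 2) + b ∧ b ≤ 1 := ⟨N % 2, by omega, by omega⟩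
  generalize j / 2 = j' at *
  generalize N / 2 = N' at *
  subst ha hb
  have h1 := abs_le.1 (abs_corrSum_add_sub_le k (2 * j') a)
  have h2 := abs_le.1 (abs_corrSum_add_sub_le k (2 * j' + 2 * N') (a + b))
  have h3 := abs_le.1 (abs_eta_le k)
  rw [show 2 * j' + 2 * N' + (a + b) = 2 * j' + a + (2 * N' + b) by ring] at h2
  have ha2 : (a : ℝ) ≤ 1 := by exact_mod_cast ha'
  have hb2 : (b : ℝ) ≤ 1 := by exact_mod_cast hb'
  have hb0 : (0 : ℝ) ≤ b := Nat.cast_nonneg b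
  have h4 : |(b : ℝ) * eta k| ≤ 1 := by
    rw [abs_mul, abs_of_nonneg hb0]
    exact mul_le_one₀ hb2 (abs_nonneg _) (abs_eta_le k)
  have h4 := abs_le.1 h4
  unfold corrErr
  push_cast at *
  exact abs_le.2 ⟨by linarith, by linarith⟩

theorem corrErr_two_mul (k j N : ℕ) :
    corrErr (2 * k) (2 * j) (2 * N) = 2 * corrErr k j N := by
  unfold corrErr
  rw [← mul_add, corrSum_two_mul, corrSum_two_mul, eta_two_mul]
  push_cast; ring

theorem corrErr_two_mul_add_one (k j N : ℕ) :
    corrErr (2 * k + 1) (2 * j) (2 * N) = -(corrErr k j N + corrErr (k + 1) j N) := by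
  unfold corrErr
  rw [← mul_add, corrSum_two_mul_add_one, corrSum_two_mul_add_one, eta_two_mul_add_one]
  push_cast; ring

/-- The parity recursions halve the window and reduce the lag at bounded cost. Uniformity in `j` is
what later lets the bound apply to every point of the subshift. -/
theorem exists_abs_corrErr_le_log (k : ℕ) :
    ∃ K : ℝ, 0 ≤ K ∧ ∀ j N, |corrErr k j N| ≤ K * (Nat.log 2 N + 1) := by
  induction k using Nat.strong_induction_on with
  | _ k ih =>
    have hmono (N : ℕ) : ((Nat.log 2 (N / 2) : ℕ) : ℝ) ≤ Nat.log 2 N := by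
      exact_mod_cast Nat.log_mono_right (Nat.div_le_self N 2)
    rcases Nat.even_or_odd' k with ⟨m, rfl | rfl⟩
    · rcases Nat.eq_zero_or_pos m with rfl | hm
      · refine ⟨0, le_rfl, fun j N => ?_⟩
        simp [corrErr, corrSum_zero_left, eta_zero]
      · obtain ⟨K, hK, h⟩ := ih m (by omega)
        refine ⟨2 * K + 4, by positivity, fun j N => ?_⟩
        have h1 := abs_le.1 (abs_corrErr_sub_le (2 * m) j N)
        rw [corrErr_two_mul] at h1
        have h2 := abs_le.1 (h (j / 2) (N / 2))
        have h3 := mul_le_mul_of_nonneg_left (hmono N) hK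
        have h4 : (0 : ℝ) ≤ Nat.log 2 N := Nat.cast_nonneg _
        exact abs_le.2 ⟨by nlinarith, by nlinarith⟩
    -- Lag 1 reduces to lags 0 and 1. Lag 0 has no error, so the error at most grows by 4 per
    -- halving of `N`, and the induction is on `N`.
    · rcases Nat.eq_zero_or_pos m with rfl | hm
      · refine ⟨4, by norm_num, fun j N => ?_⟩
        induction N using Nat.strong_induction_on generalizing j with
        | _ N ihN =>
          rcases lt_or_ge N 2 with hN | hN
          · have h1 := abs_corrErr_le (2 * 0 + 1) j N
            have h2 : (N : ℝ) ≤ 1 := by exact_mod_cast Nat.lt_succ_iff.1 hN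
            have h4 : (0 : ℝ) ≤ Nat.log 2 N := Nat.cast_nonneg _
            linarith
          · have h1 := abs_le.1 (abs_corrErr_sub_le (2 * 0 + 1) j N)
            rw [corrErr_two_mul_add_one] at h1
            have h2 := abs_le.1 (ihN (N / 2) (by omega) (j / 2))
            have h0 : corrErr 0 (j / 2) (N / 2) = 0 := by
              simp [corrErr, corrSum_zero_left, eta_zero]
            have h3 : Nat.log 2 N = Nat.log 2 (N / 2) + 1 :=
              Nat.log_of_one_lt_of_le (by norm_num) hN
            have h3' : (Nat.log 2 N : ℝ) = Nat.log 2 (N / 2) + 1 := by exact_mod_cast h3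
            rw [h0] at h1
            rw [h3']
            simp only [mul_zero, zero_add] at *
            exact abs_le.2 ⟨by linarith, by linarith⟩
      · obtain ⟨K, hK, h⟩ := ih m (by omega)
        obtain ⟨K', hK', h'⟩ := ih (m + 1) (by omega)
        refine ⟨K + K' + 4, by positivity, fun j N => ?_⟩
        have h1 := abs_le.1 (abs_corrErr_sub_le (2 * m + 1) j N)
        rw [corrErr_two_mul_add_one] at h1
        have h2 := abs_le.1 (h (j / 2) (N / 2))
        have h2' := abs_le.1 (h' (j / 2) (N / 2))
        have h3 := mul_le_mul_of_nonneg_left (hmono N) hK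
        have h3' := mul_le_mul_of_nonneg_left (hmono N) hK'
        have h4 : (0 : ℝ) ≤ Nat.log 2 N := Nat.cast_nonneg _
        exact abs_le.2 ⟨by nlinarith, by nlinarith⟩

theorem tendsto_log_add_one_div :
    Tendsto (fun N : ℕ => ((Nat.log 2 N : ℝ) + 1) / N) atTop (𝓝 0) := by
  have h1 : Tendsto (fun N : ℕ => Real.log N / N) atTop (𝓝 0) := by
    have := Real.isLittleO_log_id_atTop.tendsto_div_nhds_zero
    exact this.comp tendsto_natCast_atTop_atTop
  have h2 : Tendsto (fun N : ℕ => (1 : ℝ) / N) atTop (𝓝 0) := tendsto_one_div_atTop_nhds_zero_nat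
  have h3 : Tendsto (fun N : ℕ => Real.log N / N / Real.log 2 + 1 / N) atTop (𝓝 0) := by
    simpa using (h1.div_const (Real.log 2)).add h2
  refine squeeze_zero (fun N => by positivity) (fun N => ?_) h3
  rw [add_div, div_right_comm]
  gcongr
  have := Real.natLog_le_logb N 2
  simpa [Real.logb] using this

theorem exists_tendsto_zero_abs_corrErr_div_le (k : ℕ) :
    ∃ e : ℕ → ℝ, Tendsto e atTop (𝓝 0) ∧ ∀ j N, |corrErr k j N| / N ≤ e N := by
  obtain ⟨K, hK, h⟩ := exists_abs_corrErr_le_log k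
  refine ⟨fun N => K * (((Nat.log 2 N : ℝ) + 1) / N), ?_, fun j N => ?_⟩
  · simpa using tendsto_log_add_one_div.const_mul K
  · simp only [← mul_div_assoc]
    exact div_le_div_of_nonneg_right (h j N) (Nat.cast_nonneg N)

theorem tendsto_correlation (k : ℕ) : Tendsto
    (fun N : ℕ => (1 / (N : ℂ)) * ∑ n ∈ Finset.Icc 1 N, sign (n + k) * sign n)
    atTop (𝓝 (eta k : ℂ)) := by
  have hsum (N : ℕ) : ∑ n ∈ Finset.Icc 1 N, sign (n + k) * sign n =
      ((corrSum k (1 + N) - corrSum k 1 : ℝ) : ℂ) := by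
    rw [corrSum, corrSum, Finset.sum_range_add_sub_sum_range]
    push_cast
    rw [← Finset.Ico_add_one_right_eq_Icc, Finset.sum_Ico_eq_sum_range]
    simp [sign_eq]
  obtain ⟨e, he, h⟩ := exists_tendsto_zero_abs_corrErr_div_le k
  have hreal : Tendsto (fun N : ℕ => (1 / (N : ℝ)) * (corrSum k (1 + N) - corrSum k 1))
      atTop (𝓝 (eta k)) := by
    rw [tendsto_iff_norm_sub_tendsto_zero]
    refine squeeze_zero' (Eventually.of_forall fun N => norm_nonneg _) ?_ he
    filter_upwards [eventually_gt_atTop 0] with N hN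
    have hN' : (N : ℝ) ≠ 0 := by positivity
    refine le_trans (le_of_eq ?_) (h 1 N)
    rw [Real.norm_eq_abs, ← abs_of_nonneg (Nat.cast_nonneg (α := ℝ) N), ← abs_div,
      abs_of_nonneg (Nat.cast_nonneg (α := ℝ) N), corrErr]
    congr 1
    field_simp
  have := (Complex.continuous_ofReal.tendsto _).comp hreal
  refine this.congr fun N => ?_
  simp only [Function.comp, hsum]
  push_cast; rfl

/-- The correlation coefficients indexed by all integers. -/
noncomputable def etaInt (k : ℤ) : ℝ := eta k.natAbs

theorem etaInt_neg (k : ℤ) : etaInt (-k) = etaInt k := by simp [etaInt]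

theorem etaInt_natCast (k : ℕ) : etaInt k = eta k := by simp [etaInt]

theorem etaInt_two_mul (k : ℤ) : etaInt (2 * k) = etaInt k := by
  rw [etaInt, Int.natAbs_mul, show (2 : ℤ).natAbs = 2 from rfl, eta_two_mul, etaInt]

theorem etaInt_two_mul_add_one (k : ℤ) :
    etaInt (2 * k + 1) = -(etaInt k + etaInt (k + 1)) / 2 := by
  rcases le_or_gt 0 k with hk | hk
  · lift k to ℕ using hk
    exact_mod_cast eta_two_mul_add_one k
  · obtain ⟨m, rfl⟩ : ∃ m : ℕ, k = -((m + 1 : ℕ) : ℤ) := ⟨(-k - 1).toNat, by omega⟩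
    have h1 : (2 * -((m + 1 : ℕ) : ℤ) + 1) = -((2 * m + 1 : ℕ) : ℤ) := by push_cast; ring
    have h2 : (-((m + 1 : ℕ) : ℤ) + 1) = -(m : ℤ) := by push_cast; ring
    rw [h1, h2, etaInt_neg, etaInt_neg, etaInt_neg, etaInt_natCast, etaInt_natCast, etaInt_natCast,
      eta_two_mul_add_one]
    ring

theorem etaInt_two_pow_mul (n : ℕ) (k : ℤ) : etaInt (2 ^ n * k) = etaInt k := by
  induction n with
  | zero => simp
  | succ n ih => rw [pow_succ', mul_assoc, etaInt_two_mul, ih]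

/-- A sequence with `u (n+1) = c - u n / 2` converges to `2 c / 3`. -/
theorem tendsto_of_affine_recurrence {𝕜 : Type*} [RCLike 𝕜] {u : ℕ → 𝕜} {c : 𝕜}
    (h : ∀ n, u (n + 1) = c - u n / 2) :
    Tendsto u atTop (𝓝 (2 * c / 3)) := by
  have h1 (n : ℕ) : u n = 2 * c / 3 + (u 0 - 2 * c / 3) * (-1 / 2) ^ n := by
    induction n with
    | zero => simp
    | succ n ih => rw [h, ih, pow_succ]; ring
  have h2 : Tendsto (fun n : ℕ => (-1 / 2 : 𝕜) ^ n) atTop (𝓝 0) :=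
    tendsto_pow_atTop_nhds_zero_of_norm_lt_one (by
      rw [norm_div, norm_neg, norm_one, RCLike.norm_ofNat]; norm_num)
  rw [funext h1]
  simpa using (h2.const_mul (u 0 - 2 * c / 3)).const_add (2 * c / 3)

/-- Mixing of the doubling map, on characters. -/
theorem tendsto_etaInt_two_pow_mul_add (a : ℤ) (b : ℕ) :
    Tendsto (fun n : ℕ => etaInt (2 ^ n * a + b)) atTop (𝓝 (etaInt a * eta b)) := by
  induction b using Nat.strong_induction_on with
  | _ b ih =>
    rcases Nat.even_or_odd' b with ⟨m, rfl | rfl⟩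
    · rcases Nat.eq_zero_or_pos m with rfl | hm
      · simp [etaInt_two_pow_mul, eta_zero]
      · rw [← tendsto_add_atTop_iff_nat 1, eta_two_mul]
        refine (ih m (by omega)).congr fun n => ?_
        rw [← etaInt_two_mul]; congr 1; push_cast; ring
    · have hrec (n : ℕ) : etaInt (2 ^ (n + 1) * a + (2 * m + 1 : ℕ)) =
          -(etaInt (2 ^ n * a + m) + etaInt (2 ^ n * a + (m + 1 : ℕ))) / 2 := by
        rw [show (2 ^ (n + 1) * a + (2 * m + 1 : ℕ) : ℤ) = 2 * (2 ^ n * a + m) + 1 by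
          push_cast; ring, etaInt_two_mul_add_one]
        push_cast; rw [add_assoc]
      -- For b = 1 the recursion refers to b = 1 again, one step earlier, with factor -1/2: a
      -- contraction.
      rcases Nat.eq_zero_or_pos m with rfl | hm
      · have := tendsto_of_affine_recurrence (c := -etaInt a / 2)
          (u := fun n : ℕ => etaInt (2 ^ n * a + (2 * 0 + 1 : ℕ))) (fun n => by
            rw [hrec]; simp [etaInt_two_pow_mul]; ring)
        convert this using 2
        rw [mul_zero, zero_add, eta_one]; ring
      · rw [← tendsto_add_atTop_iff_nat 1]
        have := ((ih m (by omega)).add (ih (m + 1) (by omega))).neg.div_const 2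
        rw [eta_two_mul_add_one]
        convert this using 2 with n
        · exact hrec n
        · ring

/-! ### 2-adic valuations of the correlation coefficients -/

/-- An odd index 2m+1 averages η(m) and η(m+1), up to sign. Of m and m+1 the even one has a
denominator smaller by a factor 2, so it adds an even numerator to the odd one of its neighbour: the
denominator grows by exactly one factor 2 per binary digit. The pattern starts only beyond 8, since
η(5) = η(7) = 0. -/
theorem eta_dyadic (t : ℕ) :
    (∀ k ≤ 2 ^ (t + 3), ∃ z : ℤ, 3 * eta k * 2 ^ t = z) ∧
    (∀ k, Odd k → 2 ^ (t + 3) < k → k < 2 ^ (t + 4) →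
      ∃ z : ℤ, Odd z ∧ 3 * eta k * 2 ^ (t + 1) = z) := by
  have e2 : eta 2 = -1 / 3 := (eta_two_mul 1).trans eta_one
  have e3 : eta (2 * 1 + 1) = 1 / 3 := by
    rw [eta_two_mul_add_one 1, eta_one, e2]; norm_num
  have e4 : eta 4 = -1 / 3 := (eta_two_mul 2).trans e2
  have e5 : eta (2 * 2 + 1) = 0 := by
    rw [eta_two_mul_add_one 2, e3, e2]; norm_num
  have e6 : eta 6 = 1 / 3 := (eta_two_mul 3).trans e3
  have e7 : eta (2 * 3 + 1) = 0 := by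
    rw [eta_two_mul_add_one 3, e3, e4]; norm_num
  norm_num at e3 e5 e7
  have e8 : eta 8 = -1 / 3 := (eta_two_mul 4).trans e4
  induction t with
  | zero =>
    constructor
    · intro k hk
      norm_num at hk
      interval_cases k
      · exact ⟨3, by rw [eta_zero]; norm_num⟩
      · exact ⟨-1, by rw [eta_one]; norm_num⟩
      · exact ⟨-1, by rw [e2]; norm_num⟩
      · exact ⟨1, by rw [e3]; norm_num⟩
      · exact ⟨-1, by rw [e4]; norm_num⟩
      · exact ⟨0, by rw [e5]; norm_num⟩
      · exact ⟨1, by rw [e6]; norm_num⟩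
      · exact ⟨0, by rw [e7]; norm_num⟩
      · exact ⟨-1, by rw [e8]; norm_num⟩
    · rintro k ⟨m, rfl⟩ h1 h2
      norm_num at h1 h2
      have h3 : 4 ≤ m := by omega
      have h4 : m < 8 := by omega
      rw [eta_two_mul_add_one]
      interval_cases m
      · exact ⟨1, by decide, by rw [e4, e5]; norm_num⟩
      · exact ⟨-1, by decide, by rw [e5, e6]; norm_num⟩
      · exact ⟨-1, by decide, by rw [e6, e7]; norm_num⟩
      · exact ⟨1, by decide, by rw [e7, e8]; norm_num⟩
  | succ t ih =>
    obtain ⟨iha, ihb⟩ := ih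
    have hp3 : 2 ^ (t + 1 + 3) = 2 * 2 ^ (t + 3) := by ring
    have hp2 : 2 ^ (t + 3) = 2 * 2 ^ (t + 2) := by ring
    have hp4 : 2 ^ (t + 4) = 2 * 2 ^ (t + 3) := by ring
    have hp5 : 2 ^ (t + 1 + 4) = 4 * 2 ^ (t + 3) := by ring
    have heven (k : ℕ) (hk : Even k) (hk2 : k ≤ 2 ^ (t + 1 + 3)) :
        ∃ z : ℤ, Even z ∧ 3 * eta k * 2 ^ (t + 1) = z := by
      obtain ⟨l, rfl⟩ := hk.two_dvd
      obtain ⟨z, hz⟩ := iha l (by omega)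
      refine ⟨2 * z, even_two_mul z, ?_⟩
      rw [eta_two_mul, pow_succ, ← mul_assoc, hz]; push_cast; ring
    refine ⟨fun k hk => ?_, ?_⟩
    · rcases Nat.even_or_odd k with hk2 | hk2
      · obtain ⟨z, -, hz⟩ := heven k hk2 hk
        exact ⟨z, hz⟩
      · rcases le_or_gt k (2 ^ (t + 3)) with hk3 | hk3
        · obtain ⟨z, hz⟩ := iha k hk3
          exact ⟨2 * z, by rw [pow_succ, ← mul_assoc, hz]; push_cast; ring⟩
        · obtain ⟨z, -, hz⟩ := ihb k hk2 hk3 (by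
            rcases hk2 with ⟨l, rfl⟩
            omega)
          exact ⟨z, hz⟩
    · rintro k ⟨m, rfl⟩ h1 h2
      rw [eta_two_mul_add_one]
      rcases Nat.even_or_odd m with hm | hm
      · obtain ⟨z, hz, hz'⟩ := heven m hm (by omega)
        obtain ⟨w, hw, hw'⟩ := ihb (m + 1) hm.add_one (by omega) (by
          obtain ⟨l, rfl⟩ := hm
          omega)
        refine ⟨-(z + w), (hz.add_odd hw).neg, ?_⟩
        push_cast
        rw [← hz', ← hw']; ring
      · obtain ⟨z, hz, hz'⟩ := heven (m + 1) hm.add_one (by omega)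
        obtain ⟨w, hw, hw'⟩ := ihb m hm (by
          obtain ⟨l, rfl⟩ := hm
          omega) (by omega)
        refine ⟨-(z + w), (hz.add_odd hw).neg, ?_⟩
        push_cast
        rw [← hz', ← hw']; ring

/-- For odd `k > 8` the coefficient determines the binary length of `k`. -/
theorem eta_eq_odd_div (k : ℕ) (hk : Odd k) (h8 : 8 < k) :
    ∃ z : ℤ, Odd z ∧ 3 * eta k * 2 ^ Nat.log 2 k = 4 * z := by
  have h3 : 3 ≤ Nat.log 2 k := (Nat.le_log_iff_pow_le (by norm_num) (by omega)).2 (by omega)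
  obtain ⟨t, ht⟩ := Nat.exists_eq_add_of_le' h3
  have h1 : 2 ^ (t + 3) ≤ k := ht ▸ Nat.pow_log_le_self 2 (by omega)
  have h2 : k < 2 ^ (t + 4) := by
    have := Nat.lt_pow_succ_log_self (b := 2) (by norm_num) k
    rwa [ht] at this
  have h1' : 2 ^ (t + 3) < k := by
    refine lt_of_le_of_ne h1 fun h => ?_
    rw [← h] at hk
    exact (Nat.not_even_iff_odd.2 hk) (by simp [Nat.even_pow])
  obtain ⟨z, hz, hz'⟩ := (eta_dyadic t).2 k hk h1' h2
  exact ⟨z, hz, by rw [ht, ← hz']; ring⟩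

/-- An odd k is chosen so that qk just exceeds a power of 2 that pk does not reach. The two products
then have different binary lengths, hence η has different 2-adic valuations there. -/
theorem exists_eta_mul_ne_of_lt {p q : ℕ} (hp : Odd p) (hq : Odd q) (hpq : p < q) :
    ∃ k : ℕ, eta (p * k) ≠ eta (q * k) := by
  have hp0 : 0 < p := hp.pos
  -- Any n with 2^n > 16pq works: it forces pk > 8, and makes the overshoot of qk beyond 2^n too
  -- small for pk to reach 2^n.
  set n := 16 * (p * q)
  have hn : 16 * (p * q) < 2 ^ n := Nat.lt_two_pow_self
  -- One of two consecutive integers is odd.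
  obtain ⟨k, hk, h1, h2⟩ : ∃ k, Odd k ∧ 2 ^ n / q + 1 ≤ k ∧ k ≤ 2 ^ n / q + 2 := by
    rcases Nat.even_or_odd (2 ^ n / q) with h | h
    · exact ⟨_, h.add_one, le_rfl, by omega⟩
    · exact ⟨2 ^ n / q + 2, h.add_even (by decide), by omega, le_rfl⟩
  have hdiv := Nat.div_add_mod (2 ^ n) q
  have hmod := Nat.mod_lt (2 ^ n) (by omega : q > 0)
  set u := 2 ^ n / q
  have hqk : 2 ^ n < q * k := by nlinarith
  have hpk : p * k < 2 ^ n := by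
    have h3 : q * (p * k) ≤ p * (q * u + 2 * q) := by
      calc q * (p * k) = p * (q * k) := by ring
        _ ≤ p * (q * (u + 2)) := by gcongr
        _ = _ := by ring
    have h4 : p * (q * u) ≤ p * 2 ^ n := Nat.mul_le_mul_left _ (by omega)
    have h5 : (p + 1) * 2 ^ n ≤ q * 2 ^ n := Nat.mul_le_mul_right _ hpq
    have h6 : q * (p * k) < q * 2 ^ n := by nlinarith
    exact lt_of_mul_lt_mul_left h6 (Nat.zero_le q)
  have h8 : 8 < p * k := by
    have h3 : q * 8 < q * (p * k) := by
      have h4 := Nat.mul_le_mul_right q hp0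
      have h5 : q * k ≤ q * (p * k) := Nat.mul_le_mul_left _ (Nat.le_mul_of_pos_left k hp0)
      linarith
    exact lt_of_mul_lt_mul_left h3 (Nat.zero_le q)
  have h8' : 8 < q * k := by omega
  refine ⟨k, fun heq => ?_⟩
  obtain ⟨z, hz, hz'⟩ := eta_eq_odd_div _ (hp.mul hk) h8
  obtain ⟨w, hw, hw'⟩ := eta_eq_odd_div _ (hq.mul hk) h8'
  have hl1 : Nat.log 2 (p * k) < n := Nat.log_lt_of_lt_pow (by omega) hpk
  have hl2 : n ≤ Nat.log 2 (q * k) := Nat.le_log_of_pow_le (by norm_num) hqk.le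
  obtain ⟨d, hd⟩ := Nat.exists_eq_add_of_lt (hl1.trans_le hl2)
  rw [hd, ← heq] at hw'
  have : (w : ℝ) = z * 2 ^ (d + 1) := by
    have : (4 : ℝ) * w = 4 * z * 2 ^ (d + 1) := by rw [← hw', ← hz']; ring
    linarith
  have h9 : w = z * 2 ^ (d + 1) := by exact_mod_cast this
  rw [h9] at hw
  exact (Int.not_even_iff_odd.2 hw) ((Int.even_pow.2 ⟨by decide, by omega⟩).mul_left z)

theorem exists_eta_mul_ne {p q : ℕ} (hp : Odd p) (hq : Odd q) (hpq : p ≠ q) :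
    ∃ k : ℕ, eta (p * k) ≠ eta (q * k) := by
  rcases lt_or_gt_of_ne hpq with h | h
  · exact exists_eta_mul_ne_of_lt hp hq h
  · obtain ⟨k, hk⟩ := exists_eta_mul_ne_of_lt hq hp h
    exact ⟨k, hk.symm⟩

/-! ### Trigonometric polynomials on the circle -/

/-- The character `z ↦ z ^ n` of the circle. -/
noncomputable def monomial (n : ℤ) : C(Circle, ℂ) :=
  ⟨fun z => ((z ^ n : Circle) : ℂ), continuous_subtype_val.comp (continuous_zpow n)⟩

theorem monomial_apply (n : ℤ) (z : Circle) : monomial n z = (z : ℂ) ^ n := by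
  simp [monomial]

/-- The star subalgebra generated by the characters. -/
noncomputable def monomialSubalgebra : StarSubalgebra ℂ C(Circle, ℂ) where
  toSubalgebra := Algebra.adjoin ℂ (Set.range monomial)
  star_mem' := by
    change Algebra.adjoin ℂ (Set.range monomial) ≤ star (Algebra.adjoin ℂ (Set.range monomial))
    refine Algebra.adjoin_le ?_
    rintro - ⟨n, rfl⟩
    refine Algebra.subset_adjoin ⟨-n, ContinuousMap.ext fun z => ?_⟩
    change (((z ^ (-n) : Circle)) : ℂ) = (starRingEnd ℂ) ((z ^ n : Circle) : ℂ)
    rw [zpow_neg, Circle.coe_inv_eq_conj]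

theorem monomialSubalgebra_coe :
    Subalgebra.toSubmodule monomialSubalgebra.toSubalgebra =
      Submodule.span ℂ (Set.range monomial) := by
  apply Algebra.adjoin_eq_span_of_subset
  refine Set.Subset.trans ?_ Submodule.subset_span
  intro x hx
  refine Submonoid.closure_induction (fun _ => id) ⟨0, ?_⟩ ?_ hx
  · ext1 z; simp [monomial]
  · rintro - - - - ⟨m, rfl⟩ ⟨n, rfl⟩
    refine ⟨m + n, ?_⟩
    ext1 z
    simp [monomial, zpow_add]

theorem monomialSubalgebra_separatesPoints : monomialSubalgebra.SeparatesPoints := by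
  intro x y hxy
  refine ⟨_, ⟨monomial 1, Algebra.subset_adjoin ⟨1, rfl⟩, rfl⟩, ?_⟩
  simpa [monomial, Circle.coe_inj] using hxy

theorem span_monomial_closure_eq_top :
    (Submodule.span ℂ (Set.range monomial)).topologicalClosure = ⊤ := by
  rw [← monomialSubalgebra_coe]
  exact congr_arg (Subalgebra.toSubmodule <| StarSubalgebra.toSubalgebra ·)
    (ContinuousMap.starSubalgebra_topologicalClosure_eq_top_of_separatesPoints
      monomialSubalgebra monomialSubalgebra_separatesPoints)

/-- The trigonometric polynomial with coefficients `c`. -/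
noncomputable def trig (c : ℤ →₀ ℂ) : C(Circle, ℂ) := c.sum fun n a => a • monomial n

theorem trig_apply (c : ℤ →₀ ℂ) (z : Circle) :
    trig c z = ∑ n ∈ c.support, c n * (z : ℂ) ^ n := by
  simp [trig, Finsupp.sum, monomial_apply, ContinuousMap.sum_apply]

theorem exists_trig_approx (f : C(Circle, ℂ)) {ε : ℝ} (hε : 0 < ε) :
    ∃ c : ℤ →₀ ℂ, ∀ z, ‖trig c z - f z‖ < ε := by
  have h : f ∈ (Submodule.span ℂ (Set.range monomial)).topologicalClosure := by
    rw [span_monomial_closure_eq_top]; trivial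
  obtain ⟨g, hg, hfg⟩ := Metric.mem_closure_iff.1 h ε hε
  obtain ⟨c, rfl⟩ := Finsupp.mem_span_range_iff_exists_finsupp.1 hg
  refine ⟨c, fun z => ?_⟩
  rw [dist_comm, dist_eq_norm] at hfg
  exact (ContinuousMap.norm_coe_le_norm (trig c - f) z).trans_lt hfg

theorem integrable_continuousMap {X : Type*} [TopologicalSpace X] [CompactSpace X]
    [MeasurableSpace X] [OpensMeasurableSpace X] (ν : Measure X) [IsFiniteMeasure ν]
    (f : C(X, ℂ)) : Integrable f ν :=
  (BoundedContinuousFunction.mkOfCompact f).integrable ν |>.congr (by rfl)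

theorem integrable_zpow (ν : Measure Circle) [IsFiniteMeasure ν] (n : ℤ) :
    Integrable (fun z : Circle => (z : ℂ) ^ n) ν :=
  (integrable_continuousMap ν (monomial n)).congr (by
    filter_upwards with z using monomial_apply n z)

theorem measurable_zpow (n : ℤ) : Measurable (fun z : Circle => (z : ℂ) ^ n) := by
  rw [← funext (monomial_apply n)]
  exact (monomial n).continuous.measurable

theorem measure_ext_of_integral_zpow {μ ν : Measure Circle} [IsFiniteMeasure μ]
    [IsFiniteMeasure ν]
    (h : ∀ n : ℤ, ∫ z : Circle, (z : ℂ) ^ n ∂μ = ∫ z : Circle, (z : ℂ) ^ n ∂ν) : μ = ν := by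
  have htrig (c : ℤ →₀ ℂ) : ∫ z, trig c z ∂μ = ∫ z, trig c z ∂ν := by
    simp only [trig_apply]
    rw [integral_finsetSum _ fun n _ => (integrable_zpow μ n).const_mul _,
      integral_finsetSum _ fun n _ => (integrable_zpow ν n).const_mul _]
    simp [integral_const_mul, h]
  have hcont (f : C(Circle, ℂ)) : ∫ z, f z ∂μ = ∫ z, f z ∂ν := by
    rw [← sub_eq_zero, ← norm_le_zero_iff]
    refine le_of_forall_pos_le_add fun ε hε => ?_
    set M := μ.real Set.univ + ν.real Set.univ + 1 with hM
    have hM0 : 0 < M := by positivity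
    obtain ⟨c, hc⟩ := exists_trig_approx f (div_pos hε hM0)
    have key (ρ : Measure Circle) [IsFiniteMeasure ρ] :
        ‖∫ z, trig c z ∂ρ - ∫ z, f z ∂ρ‖ ≤ ε / M * ρ.real Set.univ := by
      rw [← integral_sub (integrable_continuousMap ρ _) (integrable_continuousMap ρ _)]
      exact norm_integral_le_of_norm_le_const (Eventually.of_forall fun z => (hc z).le)
    have h1 := key μ
    have h2 := key ν
    rw [htrig] at h1
    rw [zero_add]
    calc ‖∫ z, f z ∂μ - ∫ z, f z ∂ν‖
        = ‖(∫ z, trig c z ∂ν - ∫ z, f z ∂ν) - (∫ z, trig c z ∂ν - ∫ z, f z ∂μ)‖ := by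
          congr 1; ring
      _ ≤ ε / M * ν.real Set.univ + ε / M * μ.real Set.univ := (norm_sub_le _ _).trans (by gcongr)
      _ = ε * ((μ.real Set.univ + ν.real Set.univ) / M) := by ring
      _ ≤ ε * 1 := by
          gcongr
          rw [div_le_one hM0]; linarith
      _ = ε := mul_one ε
  refine ext_of_forall_integral_eq_of_IsFiniteMeasure fun f => ?_
  have h1 := hcont ⟨fun z => (f z : ℂ), by fun_prop⟩
  simp only [ContinuousMap.coe_mk, integral_complex_ofReal] at h1
  exact_mod_cast h1

theorem integral_zpow_neg (ν : Measure Circle) (n : ℤ) :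
    ∫ z : Circle, (z : ℂ) ^ (-n) ∂ν = (starRingEnd ℂ) (∫ z : Circle, (z : ℂ) ^ n ∂ν) := by
  rw [← integral_conj]
  congr 1; ext z
  rw [zpow_neg, ← Circle.coe_zpow, ← Circle.coe_inv_eq_conj, Circle.coe_inv]

theorem measure_ext_of_integral_pow {μ ν : Measure Circle} [IsFiniteMeasure μ]
    [IsFiniteMeasure ν]
    (h : ∀ n : ℕ, ∫ z : Circle, (z : ℂ) ^ n ∂μ = ∫ z : Circle, (z : ℂ) ^ n ∂ν) : μ = ν := by
  refine measure_ext_of_integral_zpow fun n => ?_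
  obtain ⟨m, rfl | rfl⟩ := n.eq_nat_or_neg
  · simpa using h m
  · rw [integral_zpow_neg, integral_zpow_neg]
    simp only [zpow_natCast, h m]

/-- Weak limits of probability measures on compact spaces along an ultrafilter. -/
theorem exists_weak_limit {X : Type*} [TopologicalSpace X] [CompactSpace X] [T2Space X]
    [MeasurableSpace X] [BorelSpace X] (ν : ℕ → ProbabilityMeasure X) :
    ∃ σ : ProbabilityMeasure X, ∀ f : C(X, ℂ),
      Tendsto (fun n => ∫ x, f x ∂(ν n : Measure X)) (hyperfilter ℕ)
        (𝓝 (∫ x, f x ∂(σ : Measure X))) := by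
  obtain ⟨σ, -, hσ⟩ := isCompact_univ.ultrafilter_le_nhds ((hyperfilter ℕ).map ν) (by simp)
  refine ⟨σ, fun f => ?_⟩
  have h : Tendsto ν (hyperfilter ℕ) (𝓝 σ) := hσ
  exact (ProbabilityMeasure.tendsto_iff_forall_integral_rclike_tendsto ℂ).1 h
    (BoundedContinuousFunction.mkOfCompact f)

/-- Compactness gives a weak limit along an ultrafilter finer than `atTop`, and the convergent
moments identify its moments. -/
theorem exists_measure_of_tendsto_integral_pow {ν : ℕ → Measure Circle}
    (hν : ∀ n, IsProbabilityMeasure (ν n)) {c : ℕ → ℂ}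
    (h : ∀ k : ℕ, Tendsto (fun n => ∫ z : Circle, (z : ℂ) ^ k ∂(ν n)) atTop (𝓝 (c k))) :
    ∃ σ : Measure Circle, IsProbabilityMeasure σ ∧
      ∀ k : ℕ, ∫ z : Circle, (z : ℂ) ^ k ∂σ = c k := by
  obtain ⟨σ, hσ⟩ := exists_weak_limit fun n => (⟨ν n, hν n⟩ : ProbabilityMeasure Circle)
  refine ⟨σ, inferInstance, fun k => ?_⟩
  have h1 := hσ (monomial k)
  simp only [monomial_apply, zpow_natCast] at h1
  refine tendsto_nhds_unique h1 ((h k).mono_left ?_)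
  exact Nat.hyperfilter_le_atTop

/-! ### The Thue-Morse measure on the circle -/

/-- The weight `w ↦ (1 - Re w) / 2`. -/
noncomputable def weight (w : Circle) : NNReal := ((1 - (w : ℂ).re) / 2).toNNReal

theorem re_le_one (w : Circle) : (w : ℂ).re ≤ 1 :=
  (Complex.re_le_norm _).trans_eq (Circle.norm_coe w)

theorem neg_one_le_re (w : Circle) : -1 ≤ (w : ℂ).re := by
  have := (abs_le.1 (Complex.abs_re_le_norm (w : ℂ))).1
  rwa [Circle.norm_coe] at this

theorem measurable_circle_pow (r : ℕ) : Measurable fun z : Circle => z ^ r :=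
  (continuous_pow r).measurable

theorem coe_weight (w : Circle) : (weight w : ℝ) = (1 - (w : ℂ).re) / 2 := by
  exact Real.coe_toNNReal _ (by linarith [re_le_one w])

theorem weight_le_one (w : Circle) : weight w ≤ 1 := by
  rw [← NNReal.coe_le_coe, coe_weight, NNReal.coe_one]; linarith [neg_one_le_re w]

theorem continuous_weight : Continuous weight := by
  unfold weight; fun_prop

theorem re_eq (w : Circle) : ((w : ℂ).re : ℂ) = ((w : ℂ) + (w : ℂ)⁻¹) / 2 := by
  rw [← Circle.coe_inv, Circle.coe_inv_eq_conj]
  exact Complex.re_eq_add_conj _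

theorem weight_mul_add_weight_neg_mul_even (w : Circle) (m : ℕ) :
    ((weight w : ℝ) : ℂ) * (w : ℂ) ^ (2 * m) +
      ((weight (-w) : ℝ) : ℂ) * ((-w : Circle) : ℂ) ^ (2 * m) = (w : ℂ) ^ (2 * m) := by
  rw [coe_weight, coe_weight]
  have : ((-w : Circle) : ℂ) ^ (2 * m) = (w : ℂ) ^ (2 * m) := by
    rw [Circle.coe_neg, pow_mul, pow_mul, neg_sq]
  rw [this]
  push_cast
  simp
  ring

/-- The odd power changes sign, so the weights enter through their difference -Re w = -(w + w⁻¹)/2.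
-/
theorem weight_mul_add_weight_neg_mul_odd (w : Circle) (m : ℕ) :
    ((weight w : ℝ) : ℂ) * (w : ℂ) ^ (2 * m + 1) +
      ((weight (-w) : ℝ) : ℂ) * ((-w : Circle) : ℂ) ^ (2 * m + 1) =
      -((w : ℂ) ^ (2 * m) + (w : ℂ) ^ (2 * (m + 1))) / 2 := by
  rw [coe_weight, coe_weight]
  have : ((-w : Circle) : ℂ) ^ (2 * m + 1) = -(w : ℂ) ^ (2 * m + 1) := by
    rw [Circle.coe_neg, Odd.neg_pow (odd_two_mul_add_one m)]
  rw [this]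
  have hw : (w : ℂ) ≠ 0 := w.coe_ne_zero
  have hneg : ((-w : Circle) : ℂ).re = -(w : ℂ).re := rfl
  rw [hneg]
  push_cast
  rw [re_eq]
  field_simp
  ring

/-- A measurable square root on the circle. -/
noncomputable def halfRoot (z : Circle) : Circle := Circle.exp (Complex.arg z / 2)

theorem halfRoot_sq (z : Circle) : halfRoot z ^ 2 = z := by
  rw [halfRoot, sq, ← Circle.exp_add, add_halves, Circle.exp_arg]

theorem measurable_halfRoot : Measurable halfRoot := by
  unfold halfRoot
  have h0 : Continuous fun z : Circle => (z : ℂ) := continuous_subtype_val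
  have h : Measurable fun z : Circle => (z : ℂ).arg := Complex.measurable_arg.comp h0.measurable
  exact Circle.exp.continuous.measurable.comp (h.div_const 2)

/-- The dual transfer operator of the doubling map with weight `weight`. -/
noncomputable def lift (ν : Measure Circle) : Measure Circle :=
  (ν.withDensity fun z => weight (halfRoot z)).map halfRoot +
    (ν.withDensity fun z => weight (-halfRoot z)).map fun z => -halfRoot z

theorem isFiniteMeasure_withDensity_weight (ν : Measure Circle) [IsFiniteMeasure ν]
    {f : Circle → Circle} : IsFiniteMeasure (ν.withDensity fun z => (weight (f z) : ENNReal)) := by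
  refine isFiniteMeasure_withDensity ?_
  refine ((lintegral_mono (g := fun _ => (1 : ENNReal)) fun z => ?_).trans_lt ?_).ne
  · exact ENNReal.coe_le_one_iff.2 (weight_le_one _)
  · simp

instance isFiniteMeasure_lift (ν : Measure Circle) [IsFiniteMeasure ν] :
    IsFiniteMeasure (lift ν) := by
  have h1 : IsFiniteMeasure (ν.withDensity fun z => (weight (halfRoot z) : ENNReal)) :=
    isFiniteMeasure_withDensity_weight ν
  have h2 : IsFiniteMeasure (ν.withDensity fun z => (weight (-halfRoot z) : ENNReal)) :=
    isFiniteMeasure_withDensity_weight ν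
  unfold lift
  infer_instance

theorem integral_map_withDensity_weight (ν : Measure Circle) [IsFiniteMeasure ν]
    {s : Circle → Circle} (hs : Measurable s) (k : ℕ) :
    ∫ z : Circle, (z : ℂ) ^ k ∂((ν.withDensity fun z => (weight (s z) : ENNReal)).map s) =
      ∫ z : Circle, ((weight (s z) : ℝ) : ℂ) * (s z : ℂ) ^ k ∂ν := by
  have hm : Measurable fun z : Circle => (z : ℂ) ^ k := by
    simpa using measurable_zpow k
  rw [integral_map hs.aemeasurable hm.aestronglyMeasurable,
    integral_withDensity_eq_integral_smul (f := fun z => weight (s z))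
      (continuous_weight.measurable.comp hs) fun z => (s z : ℂ) ^ k]
  rfl

theorem integrable_weight_mul (ν : Measure Circle) [IsFiniteMeasure ν]
    {s : Circle → Circle} (hs : Measurable s) (k : ℕ) :
    Integrable (fun z : Circle => ((weight (s z) : ℝ) : ℂ) * (s z : ℂ) ^ k) ν := by
  have h := integrable_continuousMap (ν.map s)
    ⟨fun z : Circle => ((weight z : ℝ) : ℂ) * (z : ℂ) ^ k, by
      have := continuous_weight
      fun_prop⟩
  exact h.comp_measurable hs

theorem integral_lift (ν : Measure Circle) [IsFiniteMeasure ν] (k : ℕ) :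
    ∫ z : Circle, (z : ℂ) ^ k ∂(lift ν) =
      ∫ z : Circle, (((weight (halfRoot z) : ℝ) : ℂ) * (halfRoot z : ℂ) ^ k +
        ((weight (-halfRoot z) : ℝ) : ℂ) * ((-halfRoot z : Circle) : ℂ) ^ k) ∂ν := by
  have h1 : IsFiniteMeasure (ν.withDensity fun z => (weight (halfRoot z) : ENNReal)) :=
    isFiniteMeasure_withDensity_weight ν
  have h2 : IsFiniteMeasure (ν.withDensity fun z => (weight (-halfRoot z) : ENNReal)) :=
    isFiniteMeasure_withDensity_weight ν
  have hneg : Measurable fun z => -halfRoot z := continuous_neg.measurable.comp measurable_halfRoot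
  have hint (ρ : Measure Circle) [IsFiniteMeasure ρ] :
      Integrable (fun z : Circle => (z : ℂ) ^ k) ρ := by
    simpa using integrable_zpow ρ k
  rw [lift, integral_add_measure (hint _) (hint _),
    integral_map_withDensity_weight ν measurable_halfRoot,
    integral_map_withDensity_weight ν hneg,
    integral_add (integrable_weight_mul ν measurable_halfRoot k) (integrable_weight_mul ν hneg k)]

/-- `lift` distributes the mass at z over its two square roots with weights of sum 1. On moments
this reproduces the recursion of `eta` at even indices; the next lemma is its odd counterpart. -/
theorem integral_lift_two_mul (ν : Measure Circle) [IsFiniteMeasure ν] (m : ℕ) :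
    ∫ z : Circle, (z : ℂ) ^ (2 * m) ∂(lift ν) = ∫ z : Circle, (z : ℂ) ^ m ∂ν := by
  rw [integral_lift]
  congr 1; ext z
  rw [weight_mul_add_weight_neg_mul_even, pow_mul, ← Circle.coe_pow, halfRoot_sq]

theorem integral_lift_two_mul_add_one (ν : Measure Circle) [IsFiniteMeasure ν] (m : ℕ) :
    ∫ z : Circle, (z : ℂ) ^ (2 * m + 1) ∂(lift ν) =
      -(∫ z : Circle, (z : ℂ) ^ m ∂ν + ∫ z : Circle, (z : ℂ) ^ (m + 1) ∂ν) / 2 := by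
  have hint (k : ℕ) : Integrable (fun z : Circle => (z : ℂ) ^ k) ν := by
    simpa using integrable_zpow ν k
  rw [integral_lift, ← integral_add (hint _) (hint _), ← integral_neg, ← integral_div]
  congr 1; ext z
  rw [weight_mul_add_weight_neg_mul_odd, pow_mul, pow_mul, ← Circle.coe_pow, halfRoot_sq]

/-- The iterates of the dual transfer operator, starting from the point mass at `1`. -/
noncomputable def approxMeasure : ℕ → Measure Circle
  | 0 => Measure.dirac 1
  | n + 1 => lift (approxMeasure n)

instance isFiniteMeasure_approxMeasure (n : ℕ) : IsFiniteMeasure (approxMeasure n) := by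
  induction n with
  | zero => rw [approxMeasure]; infer_instance
  | succ n ih => rw [approxMeasure]; infer_instance

theorem integral_approxMeasure_zero (n : ℕ) :
    ∫ z : Circle, (z : ℂ) ^ 0 ∂(approxMeasure n) = 1 := by
  induction n with
  | zero => simp [approxMeasure]
  | succ n ih => rw [approxMeasure, ← ih]; exact integral_lift_two_mul _ 0

theorem isProbabilityMeasure_approxMeasure (n : ℕ) : IsProbabilityMeasure (approxMeasure n) := by
  have h := integral_approxMeasure_zero n
  simp only [pow_zero, integral_const, mul_one, Complex.real_smul] at h
  rw [isProbabilityMeasure_iff_real]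
  exact_mod_cast h

/-- Each application of `lift` roughly halves the index. Only index 1 refers to itself, through the
contraction u ↦ -1/2 - u/2. -/
theorem tendsto_integral_approxMeasure (k : ℕ) :
    Tendsto (fun n => ∫ z : Circle, (z : ℂ) ^ k ∂(approxMeasure n)) atTop (𝓝 (eta k : ℂ)) := by
  induction k using Nat.strong_induction_on with
  | _ k ih =>
    rcases Nat.even_or_odd' k with ⟨m, rfl | rfl⟩
    · rcases Nat.eq_zero_or_pos m with rfl | hm
      · simp only [mul_zero, integral_approxMeasure_zero, eta_zero]
        simp
      · rw [← tendsto_add_atTop_iff_nat 1, eta_two_mul]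
        exact (ih m (by omega)).congr fun n => (integral_lift_two_mul _ m).symm
    · rcases Nat.eq_zero_or_pos m with rfl | hm
      · have := tendsto_of_affine_recurrence (c := (-1 / 2 : ℂ))
          (u := fun n : ℕ => ∫ z : Circle, (z : ℂ) ^ (2 * 0 + 1) ∂(approxMeasure n)) (fun n => by
            rw [approxMeasure, integral_lift_two_mul_add_one, integral_approxMeasure_zero]
            simp only [mul_zero]; ring)
        convert this using 2
        rw [mul_zero, zero_add, eta_one]; push_cast; ring
      · rw [← tendsto_add_atTop_iff_nat 1]
        have := ((ih m (by omega)).add (ih (m + 1) (by omega))).neg.div_const 2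
        rw [eta_two_mul_add_one]
        push_cast
        exact this.congr fun n => (integral_lift_two_mul_add_one _ m).symm

theorem IsSpectralMeasureOfSeq.integral_pow {σ : Measure Circle} (h : IsSpectralMeasureOfSeq σ)
    (k : ℕ) : ∫ z : Circle, (z : ℂ) ^ k ∂σ = eta k :=
  tendsto_nhds_unique (h.tendsto k) (tendsto_correlation k)

theorem IsSpectralMeasureOfSeq.integral_zpow {σ : Measure Circle} (h : IsSpectralMeasureOfSeq σ)
    (k : ℤ) : ∫ z : Circle, (z : ℂ) ^ k ∂σ = etaInt k := by
  obtain ⟨m, rfl | rfl⟩ := k.eq_nat_or_neg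
  · simpa [etaInt_natCast] using h.integral_pow m
  · rw [integral_zpow_neg, etaInt_neg, etaInt_natCast]
    simp [h.integral_pow m]

theorem existsUnique_isSpectralMeasureOfSeq : ∃! σ : Measure Circle, IsSpectralMeasureOfSeq σ := by
  obtain ⟨σ, hσ, h⟩ := exists_measure_of_tendsto_integral_pow
    isProbabilityMeasure_approxMeasure tendsto_integral_approxMeasure
  refine ⟨σ, ⟨inferInstance, fun k => h k ▸ tendsto_correlation k⟩, fun τ hτ => ?_⟩
  have := hτ.finite
  exact measure_ext_of_integral_pow fun k => (hτ.integral_pow k).trans (h k).symm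

theorem IsSpectralMeasureOfSeq.real_univ {σ : Measure Circle}
    (hσ : IsSpectralMeasureOfSeq σ) : σ.real Set.univ = 1 := by
  have h := hσ.integral_pow 0
  simp only [pow_zero, integral_const, mul_one, Complex.real_smul, eta_zero] at h
  exact_mod_cast h

theorem IsSpectralMeasureOfSeq.ne_zero {σ : Measure Circle}
    (hσ : IsSpectralMeasureOfSeq σ) : σ ≠ 0 := by
  rintro rfl
  simpa using hσ.real_univ

theorem IsSpectralMeasureOfSeq.powImage_two {σ : Measure Circle}
    (hσ : IsSpectralMeasureOfSeq σ) : powImage σ 2 = σ := by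
  have := hσ.finite
  have hfin : IsFiniteMeasure (powImage σ 2) := by unfold powImage; infer_instance
  refine measure_ext_of_integral_pow fun k => ?_
  have hm : Measurable fun z : Circle => (z : ℂ) ^ k := by simpa using measurable_zpow k
  rw [powImage, integral_map (measurable_circle_pow 2).aemeasurable hm.aestronglyMeasurable,
    hσ.integral_pow, ← eta_two_mul, ← hσ.integral_pow]
  congr 1; ext z
  rw [Circle.coe_pow, ← pow_mul]

/-- This is the self-similarity of σ: of the mass on the pair {w, -w}, the share `weight w` sits at
w. In moments it is the pair of recursions of `eta`. -/
theorem IsSpectralMeasureOfSeq.eq_withDensity {σ : Measure Circle}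
    (hσ : IsSpectralMeasureOfSeq σ) :     σ = (σ + σ.map fun z => -z).withDensity fun z => (weight z : ENNReal) := by
  have := hσ.finite
  have hneg : Measurable fun z : Circle => -z := continuous_neg.measurable
  have hfin : IsFiniteMeasure
      ((σ + σ.map fun z => -z).withDensity fun z => (weight z : ENNReal)) :=
    isFiniteMeasure_withDensity_weight (f := id) _
  refine measure_ext_of_integral_pow fun k => ?_
  have hk (ρ : Measure Circle) [IsFiniteMeasure ρ] :=
    integrable_weight_mul ρ measurable_id k
  simp only [id] at hk
  have hint (k : ℕ) : Integrable (fun z : Circle => (z : ℂ) ^ k) σ := by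
    simpa using integrable_zpow σ k
  rw [integral_withDensity_eq_integral_smul continuous_weight.measurable]
  change _ = ∫ z : Circle, ((weight z : ℝ) : ℂ) * (z : ℂ) ^ k ∂_
  rw [integral_add_measure (hk _) (hk _),
    integral_map hneg.aemeasurable (hk _).aestronglyMeasurable,
    ← integral_add (hk _) (integrable_weight_mul σ hneg k)]
  rcases Nat.even_or_odd' k with ⟨m, rfl | rfl⟩
  · simp only [weight_mul_add_weight_neg_mul_even]
  · simp only [weight_mul_add_weight_neg_mul_odd]
    rw [integral_div, integral_neg, integral_add (hint _) (hint _)]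
    simp only [hσ.integral_pow, eta_two_mul, eta_two_mul_add_one]
    push_cast; ring

theorem IsSpectralMeasureOfSeq.measure_singleton_eq {σ : Measure Circle}
    (hσ : IsSpectralMeasureOfSeq σ) (w : Circle) :     σ {w} = weight w * σ {w ^ 2} := by
  have hneg : Measurable fun z : Circle => -z := continuous_neg.measurable
  have h1 : σ {w ^ 2} = σ {w} + σ {-w} := by
    conv_lhs => rw [← hσ.powImage_two]
    rw [powImage, Measure.map_apply (measurable_circle_pow 2) (measurableSet_singleton _)]
    have : (fun z : Circle => z ^ 2) ⁻¹' {w ^ 2} = {w} ∪ {-w} := by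
      ext z
      simp only [Set.mem_preimage, Set.mem_singleton_iff, Set.mem_union]
      rw [← Circle.coe_inj, ← Circle.coe_inj, ← Circle.coe_inj, Circle.coe_pow, Circle.coe_pow,
        sq_eq_sq_iff_eq_or_eq_neg, Circle.coe_neg]
    rw [this, measure_union (by simpa using fun h => Circle.neg_ne_self w h.symm)
      (measurableSet_singleton _)]
  have h2 : σ.map (fun z => -z) {w} = σ {-w} := by
    rw [Measure.map_apply hneg (measurableSet_singleton _)]
    congr 1; ext z
    simp
  conv_lhs => rw [hσ.eq_withDensity]
  rw [withDensity_apply _ (measurableSet_singleton _), lintegral_singleton,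
    Measure.add_apply, h2, h1]

/-- The Thue-Morse measure has no atoms. -/
theorem IsSpectralMeasureOfSeq.measure_singleton {σ : Measure Circle}
    (hσ : IsSpectralMeasureOfSeq σ) (w : Circle) : σ {w} = 0 := by
  have := hσ.finite
  by_contra hw
  -- Only finitely many points are as heavy as w, so there is a heaviest atom v.
  set S : Set Circle := {z | σ {w} ≤ σ {z}} with hS
  have hfin : S.Finite := by
    refine Measure.finite_const_le_meas_of_disjoint_iUnion σ (pos_iff_ne_zero.2 hw)
      (As := fun z : Circle => ({z} : Set Circle)) (fun z => measurableSet_singleton z)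
      (fun a b hab => by simpa using hab) (measure_ne_top _ _)
  obtain ⟨v, hv, hmax⟩ := Set.exists_max_image S (fun z => σ {z}) hfin ⟨w, le_refl (σ {w})⟩
  have hv' : σ {w} ≤ σ {v} := hv
  have hv0 : σ {v} ≠ 0 := (lt_of_lt_of_le (pos_iff_ne_zero.2 hw) hv').ne'
  -- By maximality v² is exactly as heavy, which forces `weight v = 1`, so v = -1 and v² = 1. But
  -- `weight 1 = 0`, so the point 1 has no mass.
  have hle : σ {v} ≤ σ {v ^ 2} := by
    rw [hσ.measure_singleton_eq v]
    refine mul_le_of_le_one_left' ?_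
    exact ENNReal.coe_le_one_iff.2 (weight_le_one v)
  have heq : σ {v ^ 2} = σ {v} := le_antisymm (hmax _ (hv'.trans hle)) hle
  have h1 := hσ.measure_singleton_eq v
  rw [heq] at h1
  have h2 : (weight v : ENNReal) = 1 := by
    have := ENNReal.mul_left_inj hv0 (measure_ne_top σ {v}) (a := weight v) (b := 1)
    exact this.1 (by rw [one_mul]; exact h1.symm)
  have h3 : (v : ℂ).re = -1 := by
    have h4 : weight v = 1 := by exact_mod_cast h2
    have := coe_weight v
    rw [h4, NNReal.coe_one] at this
    linarith
  have h4 : v ^ 2 = 1 := by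
    have h5 := Circle.normSq_coe v
    rw [Complex.normSq_apply, h3] at h5
    have h6 : (v : ℂ).im = 0 := by nlinarith
    apply Circle.ext
    rw [Circle.coe_pow, Circle.coe_one, show (v : ℂ) = -1 from Complex.ext h3 (by simpa using h6)]
    norm_num
  have h5 := hσ.measure_singleton_eq 1
  have h6 : weight 1 = 0 := by
    rw [← NNReal.coe_inj, coe_weight]; simp
  rw [h6] at h5
  rw [h4] at heq
  apply hv0
  rw [← heq, h5]; simp

/-! ### Power images -/

theorem powImage_powImage (ν : Measure Circle) (r s : ℕ) :
    powImage (powImage ν r) s = powImage ν (r * s) := by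
  rw [powImage, powImage, Measure.map_map (measurable_circle_pow s) (measurable_circle_pow r),
    powImage]
  congr 1; ext z; simp [pow_mul]

theorem powImage_two_pow_mul {ν : Measure Circle} (h : powImage ν 2 = ν) (a r : ℕ) :
    powImage ν (2 ^ a * r) = powImage ν r := by
  induction a with
  | zero => simp
  | succ a ih => rw [pow_succ', mul_assoc, ← powImage_powImage, h, ih]

theorem integral_zpow_powImage (ν : Measure Circle) (r : ℕ) (m : ℤ) :
    ∫ z : Circle, (z : ℂ) ^ m ∂(powImage ν r) = ∫ z : Circle, (z : ℂ) ^ (r * m) ∂ν := by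
  rw [powImage, integral_map (measurable_circle_pow r).aemeasurable
    (measurable_zpow m).aestronglyMeasurable]
  congr 1; ext z
  rw [Circle.coe_pow, zpow_mul, zpow_natCast]

theorem SameType.refl (ρ : Measure Circle) : SameType ρ ρ :=
  ⟨Measure.AbsolutelyContinuous.rfl, Measure.AbsolutelyContinuous.rfl⟩

theorem SameType.symm {ρ ρ' : Measure Circle} (h : SameType ρ ρ') : SameType ρ' ρ := ⟨h.2, h.1⟩

theorem SameType.trans {ρ ρ' ρ'' : Measure Circle} (h : SameType ρ ρ') (h' : SameType ρ' ρ'') :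
    SameType ρ ρ'' := ⟨h.1.trans h'.1, h'.2.trans h.2⟩

theorem SameType.powImage {ρ ρ' : Measure Circle} (h : SameType ρ ρ') (r : ℕ) :
    SameType (powImage ρ r) (powImage ρ' r) :=
  ⟨h.1.map (measurable_circle_pow r), h.2.map (measurable_circle_pow r)⟩

theorem SameType.mutuallySingular {ρ₁ ρ₂ ν₁ ν₂ : Measure Circle} (h : SameType ρ₁ ρ₂)
    (h' : SameType ν₁ ν₂) (hs : Measure.MutuallySingular ρ₁ ν₁) :
    Measure.MutuallySingular ρ₂ ν₂ :=
  hs.mono_ac h.2 h'.2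

theorem sameType_powImage_two_pow {ν : Measure Circle} (h : SameType (powImage ν 2) ν)
    (a r : ℕ) : SameType (powImage ν r) (powImage ν (2 ^ a * r)) := by
  induction a with
  | zero => simpa using SameType.refl _
  | succ a ih =>
    refine ih.trans ?_
    rw [pow_succ', mul_assoc, ← powImage_powImage ν 2]
    exact h.symm.powImage _

theorem powImage_ne_zero {ν : Measure Circle} (h : ν ≠ 0) (r : ℕ) : powImage ν r ≠ 0 := by
  rwa [powImage, Ne, Measure.map_eq_zero_iff (measurable_circle_pow r).aemeasurable]

/-- The odd part of an integer is unique; `max` absorbs the choice of which exponent of 2 is larger.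
-/
theorem exists_max_div_eq_two_pow_iff {p q : ℕ} (hp : Odd p) (hq : Odd q) (b c : ℕ) :
    (∃ a : ℕ, max (((2 ^ b * p : ℕ) : ℚ) / (2 ^ c * q : ℕ)) (((2 ^ c * q : ℕ) : ℚ) / (2 ^ b * p : ℕ))
      = 2 ^ a) ↔ p = q := by
  have key {b c p q : ℕ} (hp : Odd p) (hq : Odd q) {a : ℕ}
      (h : ((2 ^ b * p : ℕ) : ℚ) / (2 ^ c * q : ℕ) = 2 ^ a) : p = q := by
    have hq0 : (q : ℚ) ≠ 0 := by exact_mod_cast hq.pos.ne'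
    have h1 : ((2 ^ b * p : ℕ) : ℚ) = 2 ^ a * (2 ^ c * q : ℕ) := by
      rw [div_eq_iff (by push_cast; positivity)] at h
      exact h
    have h2 : 2 ^ b * p = 2 ^ (a + c) * q := by
      have : 2 ^ b * p = 2 ^ a * (2 ^ c * q) := by exact_mod_cast h1
      rw [this, pow_add, mul_assoc]
    rcases lt_trichotomy b (a + c) with h3 | h3 | h3
    · obtain ⟨d, hd⟩ := Nat.exists_eq_add_of_lt h3
      rw [hd, add_assoc, pow_add, mul_assoc] at h2
      have h4 := Nat.eq_of_mul_eq_mul_left (by positivity) h2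
      rw [h4] at hp
      exact absurd hp (Nat.not_odd_iff_even.2 ((Nat.even_pow.2 ⟨by decide, by omega⟩).mul_right q))
    · rw [h3] at h2
      exact Nat.eq_of_mul_eq_mul_left (by positivity) h2
    · obtain ⟨d, hd⟩ := Nat.exists_eq_add_of_lt h3
      rw [hd, add_assoc, pow_add, mul_assoc] at h2
      have h4 := Nat.eq_of_mul_eq_mul_left (by positivity) h2
      rw [← h4] at hq
      exact absurd hq (Nat.not_odd_iff_even.2 ((Nat.even_pow.2 ⟨by decide, by omega⟩).mul_right p))
  have key2 {b c p : ℕ} (hp : Odd p) (hbc : c ≤ b) :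
      max (((2 ^ b * p : ℕ) : ℚ) / (2 ^ c * p : ℕ)) (((2 ^ c * p : ℕ) : ℚ) / (2 ^ b * p : ℕ))
        = 2 ^ (b - c) := by
    have hp0 : (p : ℚ) ≠ 0 := by exact_mod_cast hp.pos.ne'
    obtain ⟨d, rfl⟩ := Nat.exists_eq_add_of_le hbc
    have h1 : ((2 ^ (c + d) * p : ℕ) : ℚ) / (2 ^ c * p : ℕ) = 2 ^ d := by
      push_cast; rw [pow_add]; field_simp
    have h2 : ((2 ^ c * p : ℕ) : ℚ) / (2 ^ (c + d) * p : ℕ) = (2 ^ d)⁻¹ := by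
      rw [← h1, inv_div]
    rw [h1, h2, Nat.add_sub_cancel_left, max_eq_left]
    exact (inv_le_one_of_one_le₀ (one_le_pow₀ (by norm_num))).trans (one_le_pow₀ (by norm_num))
  constructor
  · rintro ⟨a, ha⟩
    rcases max_choice (((2 ^ b * p : ℕ) : ℚ) / (2 ^ c * q : ℕ))
      (((2 ^ c * q : ℕ) : ℚ) / (2 ^ b * p : ℕ)) with h | h
    · exact key hp hq (h ▸ ha)
    · exact (key hq hp (h ▸ ha)).symm
  · rintro rfl
    rcases le_total c b with h | h
    · exact ⟨_, key2 hp h⟩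
    · exact ⟨_, (max_comm _ _).trans (key2 hp h)⟩

/-- If the type of `ν` is invariant under squaring and the odd power images are pairwise singular
then the power images of exponents `r` and `s` are singular unless `r / s` is a power of `2`. -/
theorem mutuallySingular_powImage_iff {ν : Measure Circle} (h0 : ν ≠ 0)
    (h2 : SameType (powImage ν 2) ν)
    (hodd : ∀ p q : ℕ, Odd p → Odd q → p ≠ q →
      Measure.MutuallySingular (powImage ν p) (powImage ν q))
    {r s : ℕ} (hr : 1 ≤ r) (hs : 1 ≤ s) :
    Measure.MutuallySingular (powImage ν r) (powImage ν s) ↔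
      ¬ ∃ a : ℕ, max ((r : ℚ) / s) ((s : ℚ) / r) = 2 ^ a := by
  obtain ⟨b, p, hp, rfl⟩ := Nat.exists_eq_two_pow_mul_odd (Nat.one_le_iff_ne_zero.1 hr)
  obtain ⟨c, q, hq, rfl⟩ := Nat.exists_eq_two_pow_mul_odd (Nat.one_le_iff_ne_zero.1 hs)
  rw [exists_max_div_eq_two_pow_iff hp hq]
  have h3 := sameType_powImage_two_pow h2 b p
  have h4 := sameType_powImage_two_pow h2 c q
  constructor
  · rintro h rfl
    have h5 := h3.symm.mutuallySingular h4.symm h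
    rw [Measure.MutuallySingular.self_iff] at h5
    exact powImage_ne_zero h0 p h5
  · intro hpq
    exact h3.mutuallySingular h4 (hodd p q hp hq hpq)

/-! ### Singularity of the odd power images of the Thue-Morse measure -/

/-- Each distance d is attained at most twice, at i - d and i + d. -/
theorem sum_dist_le {f : ℕ → ℝ} (hf : ∀ d, 0 ≤ f d) {i N : ℕ} (hi : i < N) :
    ∑ j ∈ Finset.range N, f (Nat.dist i j) ≤ 2 * ∑ d ∈ Finset.range N, f d := by
  obtain ⟨M, rfl⟩ := Nat.exists_eq_add_of_lt hi
  rw [show i + M + 1 = (i + 1) + M by ring, Finset.sum_range_add, two_mul]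
  refine add_le_add ?_ ?_
  · rw [← Finset.sum_range_reflect]
    have h : ∑ j ∈ Finset.range (i + 1), f (Nat.dist i (i + 1 - 1 - j)) =
        ∑ j ∈ Finset.range (i + 1), f j := by
      refine Finset.sum_congr rfl fun j hj => ?_
      rw [Finset.mem_range] at hj
      congr 1
      unfold Nat.dist; omega
    rw [h, Finset.sum_range_add _ (i + 1) M]
    exact le_add_of_nonneg_right (Finset.sum_nonneg fun _ _ => hf _)
  · have h : ∑ j ∈ Finset.range M, f (Nat.dist i (i + 1 + j)) =
        ∑ j ∈ Finset.range M, f (1 + j) := by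
      refine Finset.sum_congr rfl fun j hj => ?_
      congr 1
      unfold Nat.dist; omega
    rw [h, show i + 1 + M = (1 + M) + i by ring, Finset.sum_range_add, Finset.sum_range_add]
    have h1 : 0 ≤ ∑ j ∈ Finset.range 1, f j := Finset.sum_nonneg fun _ _ => hf _
    have h2 : 0 ≤ ∑ j ∈ Finset.range i, f (1 + M + j) := Finset.sum_nonneg fun _ _ => hf _
    linarith

/-- The averages of the character `z ↦ z ^ k` along the orbits of the doubling map. -/
noncomputable def doublingAverage (k N : ℕ) (z : Circle) : ℂ :=
  (1 / (N : ℂ)) * ∑ j ∈ Finset.range N, (z : ℂ) ^ (k * 2 ^ j)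

theorem continuous_doublingAverage (k N : ℕ) : Continuous (doublingAverage k N) := by
  unfold doublingAverage; fun_prop

section Averages

variable {ν : Measure Circle} [IsFiniteMeasure ν] {p : ℕ}

/-- Invariance under doubling makes the covariances stationary: they depend only on the distance of
i and j. The hypothesis is the moment formula of σ^(p). -/
theorem integral_mul_conj_sub (h : ∀ m : ℤ, ∫ z : Circle, (z : ℂ) ^ m ∂ν = etaInt (p * m))
    (k i j : ℕ) :
    ∫ z : Circle, ((z : ℂ) ^ (k * 2 ^ i) - eta (p * k)) *
      (starRingEnd ℂ) ((z : ℂ) ^ (k * 2 ^ j) - eta (p * k)) ∂ν =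
    ((etaInt (2 ^ (Nat.dist i j) * (-((p * k : ℕ) : ℤ)) + (p * k : ℕ)) - eta (p * k) ^ 2 : ℝ) : ℂ)
    := by
  have hpt (z : Circle) : ((z : ℂ) ^ (k * 2 ^ i) - eta (p * k)) *
      (starRingEnd ℂ) ((z : ℂ) ^ (k * 2 ^ j) - eta (p * k)) =
      (z : ℂ) ^ ((k * 2 ^ i - k * 2 ^ j : ℤ)) - eta (p * k) * (z : ℂ) ^ ((k * 2 ^ i : ℤ)) -
        eta (p * k) * (z : ℂ) ^ (-(k * 2 ^ j : ℤ)) + (eta (p * k) : ℂ) ^ 2 * (z : ℂ) ^ (0 : ℤ) := by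
    have hz : (z : ℂ) ≠ 0 := z.coe_ne_zero
    rw [map_sub, map_pow, ← Circle.coe_inv_eq_conj, Complex.conj_ofReal, Circle.coe_inv,
      inv_pow, zpow_sub₀ hz, zpow_neg, zpow_zero]
    have h1 (l : ℕ) : (z : ℂ) ^ ((k * 2 ^ l : ℤ)) = (z : ℂ) ^ (k * 2 ^ l) := by
      exact_mod_cast zpow_natCast (z : ℂ) (k * 2 ^ l)
    rw [h1, h1]
    have h2 : (z : ℂ) ^ (k * 2 ^ j) ≠ 0 := pow_ne_zero _ hz
    field_simp
    ring
  have hint (m : ℤ) := integrable_zpow ν m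
  simp only [hpt]
  have e1 : Integrable (fun z : Circle => (z : ℂ) ^ ((k * 2 ^ i - k * 2 ^ j : ℤ)) -
      eta (p * k) * (z : ℂ) ^ ((k * 2 ^ i : ℤ))) ν := (hint _).sub ((hint _).const_mul _)
  have e2 : Integrable (fun z : Circle => (z : ℂ) ^ ((k * 2 ^ i - k * 2 ^ j : ℤ)) -
      eta (p * k) * (z : ℂ) ^ ((k * 2 ^ i : ℤ)) - eta (p * k) * (z : ℂ) ^ (-(k * 2 ^ j : ℤ))) ν :=
    e1.sub ((hint _).const_mul _)
  rw [integral_add e2 ((hint _).const_mul _), integral_sub e1 ((hint _).const_mul _),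
    integral_sub (hint _) ((hint _).const_mul _), integral_const_mul, integral_const_mul,
    integral_const_mul, h, h, h, h]
  have h3 (l : ℕ) : etaInt (p * (k * 2 ^ l : ℤ)) = eta (p * k) := by
    rw [show (p * (k * 2 ^ l : ℤ)) = 2 ^ l * ((p * k : ℕ) : ℤ) by push_cast; ring,
      etaInt_two_pow_mul, etaInt_natCast]
  have h4 : etaInt (p * (k * 2 ^ i - k * 2 ^ j : ℤ)) =
      etaInt (2 ^ (Nat.dist i j) * (-((p * k : ℕ) : ℤ)) + (p * k : ℕ)) := by
    rcases le_total i j with hij | hij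
    · obtain ⟨d, rfl⟩ := Nat.exists_eq_add_of_le hij
      rw [Nat.dist_eq_sub_of_le hij, Nat.add_sub_cancel_left,
        ← etaInt_two_pow_mul i (2 ^ d * _ + _)]
      congr 1; push_cast; ring
    · obtain ⟨d, rfl⟩ := Nat.exists_eq_add_of_le hij
      rw [Nat.dist_eq_sub_of_le_right hij, Nat.add_sub_cancel_left,
        ← etaInt_two_pow_mul j (2 ^ d * _ + _), ← etaInt_neg (2 ^ j * _)]
      congr 1; push_cast; ring
  have h6 : etaInt (p * -(k * 2 ^ j : ℤ)) = eta (p * k) := by rw [mul_neg, etaInt_neg, h3]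
  rw [h4, h3, h6]
  have h5 : etaInt ((p : ℤ) * 0) = 1 := by simp [etaInt, eta_zero]
  rw [h5]
  push_cast; ring

/-- The variance of the average is the mean of covariances r(|i - j|), at most twice the Cesàro mean
of |r|, and r tends to 0 by `tendsto_etaInt_two_pow_mul_add`. -/
theorem tendsto_integral_norm_doublingAverage_sub
    (h : ∀ m : ℤ, ∫ z : Circle, (z : ℂ) ^ m ∂ν = etaInt (p * m)) (k : ℕ) :
    Tendsto (fun N => ∫ z, ‖doublingAverage k N z - eta (p * k)‖ ^ 2 ∂ν) atTop (𝓝 0) := by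
  set r : ℕ → ℝ := fun d =>
    etaInt (2 ^ d * (-((p * k : ℕ) : ℤ)) + (p * k : ℕ)) - eta (p * k) ^ 2 with hr
  have hr0 : Tendsto (fun d => |r d|) atTop (𝓝 0) := by
    have h1 := (tendsto_etaInt_two_pow_mul_add (-((p * k : ℕ) : ℤ)) (p * k)).sub_const
      (eta (p * k) ^ 2)
    rw [etaInt_neg, etaInt_natCast, ← sq, sub_self] at h1
    have h2 := h1.abs
    rwa [abs_zero] at h2
  have hces : Tendsto (fun N : ℕ => 2 * ((N : ℝ)⁻¹ * ∑ d ∈ Finset.range N, |r d|)) atTop (𝓝 0) := by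
    simpa using hr0.cesaro.const_mul 2
  refine squeeze_zero' (Eventually.of_forall fun N => integral_nonneg fun z => by positivity) ?_ hces
  filter_upwards [eventually_gt_atTop 0] with N hN
  have hN0 : (N : ℂ) ≠ 0 := by exact_mod_cast hN.ne'
  set u : ℕ → Circle → ℂ := fun j z => (z : ℂ) ^ (k * 2 ^ j) - eta (p * k) with hu
  have hcu (j : ℕ) : Continuous (u j) := by
    simp only [hu]; fun_prop
  have hpt (z : Circle) : ((‖doublingAverage k N z - eta (p * k)‖ ^ 2 : ℝ) : ℂ) =
      ((N : ℂ)⁻¹) ^ 2 * ∑ i ∈ Finset.range N, ∑ j ∈ Finset.range N,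
        u i z * (starRingEnd ℂ) (u j z) := by
    have h1 : doublingAverage k N z - eta (p * k) = (N : ℂ)⁻¹ * ∑ j ∈ Finset.range N, u j z := by
      simp only [doublingAverage, hu, Finset.sum_sub_distrib, Finset.sum_const, Finset.card_range,
        nsmul_eq_mul, one_div]
      field_simp
    rw [← Finset.sum_mul_sum, ← map_sum, Complex.ofReal_pow, ← Complex.mul_conj', h1, map_mul,
      map_inv₀, Complex.conj_natCast]
    ring
  have hint : ((∫ z, ‖doublingAverage k N z - eta (p * k)‖ ^ 2 ∂ν : ℝ) : ℂ) =
      (((N : ℝ)⁻¹ ^ 2 * ∑ i ∈ Finset.range N, ∑ j ∈ Finset.range N, r (Nat.dist i j) : ℝ) : ℂ) := by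
    rw [← integral_complex_ofReal]
    simp only [hpt]
    have hI (i j : ℕ) : Integrable (fun z => u i z * (starRingEnd ℂ) (u j z)) ν := by
      have h1 := hcu i
      have h2 := Complex.continuous_conj.comp (hcu j)
      exact integrable_continuousMap ν ⟨_, h1.mul h2⟩
    rw [integral_const_mul, integral_finsetSum _ fun i _ => integrable_finsetSum _ fun j _ => hI i j]
    push_cast
    congr 1
    refine Finset.sum_congr rfl fun i _ => ?_
    rw [integral_finsetSum _ fun j _ => hI i j]
    refine Finset.sum_congr rfl fun j _ => ?_
    rw [integral_mul_conj_sub h k i j]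
  rw [Complex.ofReal_inj] at hint
  rw [hint]
  have hN1 : (N : ℝ) ≠ 0 := by exact_mod_cast hN.ne'
  calc (N : ℝ)⁻¹ ^ 2 * ∑ i ∈ Finset.range N, ∑ j ∈ Finset.range N, r (Nat.dist i j)
      ≤ (N : ℝ)⁻¹ ^ 2 * ∑ i ∈ Finset.range N, 2 * ∑ d ∈ Finset.range N, |r d| := by
        gcongr with i hi
        refine (Finset.sum_le_sum fun j _ => le_abs_self _).trans ?_
        exact sum_dist_le (f := fun d => |r d|) (fun d => abs_nonneg _) (Finset.mem_range.1 hi)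
    _ = _ := by
        rw [Finset.sum_const, Finset.card_range, nsmul_eq_mul]
        field_simp

/-- Starting from a given `φ` allows extraction for one measure and then, further, for another. -/
theorem exists_subseq_doublingAverage_tendsto_ae
    (h : ∀ m : ℤ, ∫ z : Circle, (z : ℂ) ^ m ∂ν = etaInt (p * m)) (k : ℕ)
    {φ : ℕ → ℕ} (hφ : Tendsto φ atTop atTop) :
    ∃ ψ : ℕ → ℕ, StrictMono ψ ∧ ∀ᵐ z ∂ν,
      Tendsto (fun n => doublingAverage k (φ (ψ n)) z) atTop (𝓝 (eta (p * k) : ℂ)) := by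
  set g : ℕ → Circle → ℝ := fun n z => ‖doublingAverage k (φ n) z - eta (p * k)‖ ^ 2 with hg
  have hgc (n : ℕ) : Continuous (g n) := by
    have := continuous_doublingAverage k (φ n)
    simp only [hg]; fun_prop
  have h1 : Tendsto (fun n => ∫ z, g n z ∂ν) atTop (𝓝 0) :=
    (tendsto_integral_norm_doublingAverage_sub h k).comp hφ
  have h2 : TendstoInMeasure ν g atTop (fun _ => (0 : ℝ)) := by
    refine tendstoInMeasure_of_tendsto_eLpNorm one_ne_zero
      (fun n => (hgc n).aestronglyMeasurable) aestronglyMeasurable_const ?_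
    have h3 := ENNReal.tendsto_ofReal h1
    rw [ENNReal.ofReal_zero] at h3
    refine h3.congr fun n => ?_
    have hI : Integrable (g n) ν := by
      have := (integrable_continuousMap ν ⟨fun z => (g n z : ℂ), by
        have := hgc n
        fun_prop⟩).re
      exact this
    have h4 := ofReal_integral_norm_eq_lintegral_enorm hI
    have h5 (z : Circle) : ‖g n z‖ = g n z := Real.norm_of_nonneg (by positivity)
    simp only [h5] at h4
    rw [h4, eLpNorm_one_eq_lintegral_enorm]
    simp
  obtain ⟨ψ, hψ, hae⟩ := h2.exists_seq_tendsto_ae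
  refine ⟨ψ, hψ, hae.mono fun z hz => ?_⟩
  have h6 := hz.sqrt
  simp only [hg, Real.sqrt_sq (norm_nonneg _), Real.sqrt_zero] at h6
  exact tendsto_iff_norm_sub_tendsto_zero.2 h6

end Averages

/-- Along a common subsequence the same averages converge to η(pk) almost everywhere for one measure
and to η(qk) ≠ η(pk) for the other, so the two convergence sets are disjoint. -/
theorem IsSpectralMeasureOfSeq.mutuallySingular_powImage {σ : Measure Circle}
    (hσ : IsSpectralMeasureOfSeq σ) {p q : ℕ} (hp : Odd p) (hq : Odd q) (hpq : p ≠ q) :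
    Measure.MutuallySingular (powImage σ p) (powImage σ q) := by
  have := hσ.finite
  have hfin (r : ℕ) : IsFiniteMeasure (powImage σ r) := by unfold powImage; infer_instance
  have hF (r : ℕ) (m : ℤ) : ∫ z : Circle, (z : ℂ) ^ m ∂(powImage σ r) = etaInt (r * m) := by
    rw [integral_zpow_powImage, hσ.integral_zpow]
  obtain ⟨k, hk⟩ := exists_eta_mul_ne hp hq hpq
  obtain ⟨φ, hφ, h1⟩ := exists_subseq_doublingAverage_tendsto_ae (hF p) k tendsto_id
  obtain ⟨ψ, hψ, h2⟩ := exists_subseq_doublingAverage_tendsto_ae (hF q) k hφ.tendsto_atTop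
  refine Measure.MutuallySingular.mk (s := {z | ¬ Tendsto (fun n => doublingAverage k (id (φ n)) z)
    atTop (𝓝 (eta (p * k) : ℂ))}) (t := {z | ¬ Tendsto (fun n => doublingAverage k (φ (ψ n)) z)
    atTop (𝓝 (eta (q * k) : ℂ))}) h1 h2 fun z _ => ?_
  by_contra hz
  simp only [Set.mem_union, Set.mem_ofPred_eq, not_or, not_not] at hz
  have h3 := tendsto_nhds_unique (hz.1.comp hψ.tendsto_atTop) hz.2
  exact hk (by exact_mod_cast h3)

/-! ### Dyadic roots of unity and convolutions with discrete measures -/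

theorem countable_dyadicRoots : dyadicRoots.Countable := by
  have h : dyadicRoots = ⋃ n : ℕ, {z : Circle | z ^ (2 ^ n) = 1} := by
    ext z; simp [dyadicRoots]
  rw [h]
  refine Set.countable_iUnion fun n => Set.Finite.countable ?_
  have hfin : {w : ℂ | w ^ (2 ^ n) = 1}.Finite := by
    refine (Polynomial.nthRoots (2 ^ n) (1 : ℂ)).toFinset.finite_toSet.subset fun w hw => ?_
    simp only [Finset.mem_coe, Multiset.mem_toFinset]
    exact (Polynomial.mem_nthRoots (by positivity)).2 hw
  refine (hfin.preimage (f := fun z : Circle => (z : ℂ))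
    Circle.coe_injective.injOn).subset fun z hz => ?_
  have hz' : z ^ (2 ^ n) = 1 := hz
  change (z : ℂ) ^ (2 ^ n) = 1
  rw [← Circle.coe_pow, hz', Circle.coe_one]

theorem one_mem_dyadicRoots : (1 : Circle) ∈ dyadicRoots := ⟨0, one_pow _⟩

theorem sq_mem_dyadicRoots {ζ : Circle} (h : ζ ∈ dyadicRoots) : ζ ^ 2 ∈ dyadicRoots := by
  obtain ⟨n, hn⟩ := h
  exact ⟨n, by rw [← pow_mul, mul_comm, pow_mul, hn, one_pow]⟩

theorem exists_sq_eq_of_mem_dyadicRoots {ζ : Circle} (h : ζ ∈ dyadicRoots) :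
    ∃ ξ ∈ dyadicRoots, ξ ^ 2 = ζ := by
  obtain ⟨n, hn⟩ := h
  exact ⟨halfRoot ζ, ⟨n + 1, by rw [pow_succ', pow_mul, halfRoot_sq, hn]⟩, halfRoot_sq ζ⟩

theorem measurable_mul_left_circle (ζ : Circle) : Measurable fun z : Circle => ζ * z :=
  (continuous_const_mul ζ).measurable

theorem exists_isDyadicDiscrete : ∃ D : Measure Circle, IsDyadicDiscrete D := by
  obtain ⟨f, hf⟩ := countable_dyadicRoots.exists_eq_range ⟨1, one_mem_dyadicRoots⟩
  have happ (E : Set Circle) (hE : MeasurableSet E) :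
      Measure.sum (fun n => ((2 : ENNReal)⁻¹ ^ n) • Measure.dirac (f n)) E =
        ∑' n, (2 : ENNReal)⁻¹ ^ n * E.indicator 1 (f n) := by
    rw [Measure.sum_apply _ hE]
    simp [Measure.dirac_apply' _ hE]
  refine ⟨Measure.sum fun n => ((2 : ENNReal)⁻¹ ^ n) • Measure.dirac (f n), ⟨⟨?_⟩, ?_, ?_⟩⟩
  · rw [happ _ MeasurableSet.univ]
    simp [ENNReal.tsum_geometric]
  · rw [happ _ countable_dyadicRoots.measurableSet.compl, ENNReal.tsum_eq_zero]
    intro n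
    have : f n ∈ dyadicRoots := hf ▸ Set.mem_range_self n
    simp [this]
  · intro z hz
    rw [hf] at hz
    obtain ⟨n, rfl⟩ := hz
    rw [happ _ (measurableSet_singleton _)]
    refine fun h => ?_
    have := ENNReal.tsum_eq_zero.1 h n
    simp at this

theorem IsDyadicDiscrete.measure_eq_zero_iff {D : Measure Circle} (hD : IsDyadicDiscrete D)
    (E : Set Circle) : D E = 0 ↔ ∀ ζ ∈ dyadicRoots, ζ ∉ E := by
  constructor
  · intro h ζ hζ hE
    exact hD.atoms ζ hζ (measure_mono_null (Set.singleton_subset_iff.2 hE) h)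
  · intro h
    exact measure_mono_null (fun ζ hζ hmem => h ζ hmem hζ) hD.carried

/-- By Fubini. All that follows about D*σ is read off from these null sets, so the masses of the
atoms of D never matter. -/
theorem IsDyadicDiscrete.mconv_apply_eq_zero_iff {D σ : Measure Circle}
    (hD : IsDyadicDiscrete D) [IsFiniteMeasure σ] {E : Set Circle} (hE : MeasurableSet E) :
    Measure.mconv D σ E = 0 ↔ ∀ ζ ∈ dyadicRoots, σ ((fun z => ζ * z) ⁻¹' E) = 0 := by
  have hm : Measurable fun x : Circle × Circle => x.1 * x.2 := measurable_mul
  have := hD.finite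
  rw [Measure.mconv, Measure.map_apply hm hE, Measure.measure_prod_null (hm hE),
    Filter.EventuallyEq, ae_iff, hD.measure_eq_zero_iff]
  simp only [Set.mem_ofPred_eq, not_not, Pi.zero_apply]
  rfl

section
variable {D σ : Measure Circle}

theorem isFiniteMeasure_mconv (hD : IsDyadicDiscrete D) [IsFiniteMeasure σ] :
    IsFiniteMeasure (Measure.mconv D σ) := by
  have := hD.finite
  unfold Measure.mconv; infer_instance

theorem IsDyadicDiscrete.mconv_ne_zero (hD : IsDyadicDiscrete D) [IsFiniteMeasure σ]
    (hσ : σ ≠ 0) : Measure.mconv D σ ≠ 0 := by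
  intro h
  have h1 := (hD.mconv_apply_eq_zero_iff (σ := σ) MeasurableSet.univ).1 (by rw [h]; simp)
    1 one_mem_dyadicRoots
  exact hσ (by simpa using h1)

theorem IsDyadicDiscrete.powImage_mconv_eq_zero_iff (hD : IsDyadicDiscrete D) [IsFiniteMeasure σ]
    {E : Set Circle} (hE : MeasurableSet E) (r : ℕ) :
    powImage (Measure.mconv D σ) r E = 0 ↔
      ∀ ζ ∈ dyadicRoots, σ ((fun z => (ζ * z) ^ r) ⁻¹' E) = 0 := by
  rw [powImage, Measure.map_apply (measurable_circle_pow r) hE,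
    hD.mconv_apply_eq_zero_iff (measurable_circle_pow r hE)]
  rfl

/-- Squaring maps the dyadic roots onto themselves and preserves σ, so it only rearranges the
rotates of σ. -/
theorem IsDyadicDiscrete.sameType_powImage_mconv (hD : IsDyadicDiscrete D) [IsFiniteMeasure σ]
    (hσ : powImage σ 2 = σ) : SameType (powImage (Measure.mconv D σ) 2) (Measure.mconv D σ) := by
  have key (E : Set Circle) (hE : MeasurableSet E) :
      powImage (Measure.mconv D σ) 2 E = 0 ↔ Measure.mconv D σ E = 0 := by
    rw [hD.powImage_mconv_eq_zero_iff hE, hD.mconv_apply_eq_zero_iff hE]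
    have h1 (ζ : Circle) : σ ((fun z => (ζ * z) ^ 2) ⁻¹' E) = σ ((fun z => ζ ^ 2 * z) ⁻¹' E) := by
      conv_rhs => rw [← hσ]
      rw [powImage, Measure.map_apply (measurable_circle_pow 2) (measurable_mul_left_circle _ hE)]
      congr 1; ext z
      simp [mul_pow]
    simp only [h1]
    constructor
    · intro h ζ hζ
      obtain ⟨ξ, hξ, rfl⟩ := exists_sq_eq_of_mem_dyadicRoots hζ
      exact h ξ hξ
    · intro h ζ hζ
      exact h _ (sq_mem_dyadicRoots hζ)
  exact ⟨Measure.AbsolutelyContinuous.mk fun E hE h => (key E hE).2 h,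
    Measure.AbsolutelyContinuous.mk fun E hE h => (key E hE).1 h⟩

/-- A set E separating σ^(p) from σ^(q) need not separate their rotates. After enough squarings
every dyadic root becomes 1 while σ is unchanged, so the limsup of the preimages of E under iterated
squaring separates all rotates at once. -/
theorem IsDyadicDiscrete.mutuallySingular_powImage_mconv (hD : IsDyadicDiscrete D)
    [IsFiniteMeasure σ] (hσ : powImage σ 2 = σ) {p q : ℕ}
    (h : Measure.MutuallySingular (powImage σ p) (powImage σ q)) :
    Measure.MutuallySingular (powImage (Measure.mconv D σ) p) (powImage (Measure.mconv D σ) q) := by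
  obtain ⟨E, hE, h1, h2⟩ := h
  have key {r : ℕ} {A : Set Circle} (hA : MeasurableSet A) (h0 : powImage σ r A = 0)
      {ζ : Circle} {m n : ℕ} (hζ : ζ ^ (2 ^ m) = 1) (hmn : m ≤ n) :
      σ ((fun z => ((ζ * z) ^ r) ^ (2 ^ n)) ⁻¹' A) = 0 := by
    rw [← powImage_two_pow_mul hσ n r, powImage, Measure.map_apply (measurable_circle_pow _) hA] at h0
    convert h0 using 2
    ext z
    have : ζ ^ (2 ^ n * r) = 1 := by
      obtain ⟨d, rfl⟩ := Nat.exists_eq_add_of_le hmn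
      rw [pow_add, mul_assoc, pow_mul, hζ, one_pow]
    simp only [Set.mem_preimage]
    rw [← pow_mul, mul_comm r, mul_pow, this, one_mul]
  set F : Set Circle := ⋂ m : ℕ, ⋃ n : ℕ, (fun z : Circle => z ^ (2 ^ (m + n))) ⁻¹' E with hF
  have hFm : MeasurableSet F :=
    MeasurableSet.iInter fun m => MeasurableSet.iUnion fun n => measurable_circle_pow _ hE
  refine ⟨F, hFm, ?_, ?_⟩
  · rw [hD.powImage_mconv_eq_zero_iff hFm]
    rintro ζ ⟨m, hm⟩
    refine measure_mono_null (t := ⋃ n : ℕ, (fun z => ((ζ * z) ^ p) ^ (2 ^ (m + n))) ⁻¹' E) ?_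
      (measure_iUnion_null fun n => key hE h1 hm (Nat.le_add_right m n))
    intro z hz
    have := Set.mem_iInter.1 hz m
    simpa using this
  -- Outside F the iterated squares lie in `Eᶜ` from some time `l` on; time `l + m` is also late
  -- enough to have killed ζ.
  · rw [hD.powImage_mconv_eq_zero_iff hFm.compl]
    rintro ζ ⟨m, hm⟩
    refine measure_mono_null
      (t := ⋃ l : ℕ, (fun z => ((ζ * z) ^ q) ^ (2 ^ (l + m))) ⁻¹' Eᶜ) ?_
      (measure_iUnion_null fun l => key hE.compl h2 hm (Nat.le_add_left m l))
    intro z hz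
    simp only [hF, Set.mem_preimage, Set.mem_compl_iff, Set.mem_iInter, Set.mem_iUnion, not_forall,
      not_exists] at hz ⊢
    obtain ⟨l, hl⟩ := hz
    exact ⟨l, hl m⟩

theorem IsDyadicDiscrete.mconv_singleton (hD : IsDyadicDiscrete D) [IsFiniteMeasure σ]
    (hσ : ∀ z, σ {z} = 0) (w : Circle) : Measure.mconv D σ {w} = 0 := by
  rw [hD.mconv_apply_eq_zero_iff (measurableSet_singleton w)]
  intro ζ _
  have : (fun z => ζ * z) ⁻¹' {w} = {ζ⁻¹ * w} := by
    ext z; simp [eq_inv_mul_iff_mul_eq]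
  rw [this, hσ]

theorem IsDyadicDiscrete.continuousPart_add_mconv (hD : IsDyadicDiscrete D) [IsFiniteMeasure σ]
    (hσ : ∀ z, σ {z} = 0) :
    continuousPart (D + Measure.mconv D σ) = Measure.mconv D σ := by
  have hset : {z | (D + Measure.mconv D σ) {z} = 0} = dyadicRootsᶜ := by
    ext z
    simp only [Measure.add_apply, hD.mconv_singleton hσ, add_zero, Set.mem_ofPred_eq,
      hD.measure_eq_zero_iff, Set.mem_singleton_iff, Set.mem_compl_iff]
    exact ⟨fun h hz => h z hz rfl, fun h ζ hζ hz => h (hz ▸ hζ)⟩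
  rw [continuousPart, hset, Measure.restrict_add, Measure.restrict_eq_zero.2 hD.carried, zero_add]
  refine Measure.restrict_eq_self_of_ae_mem ?_
  rw [ae_iff]
  simp only [Set.mem_compl_iff, not_not]
  have : {z | z ∈ dyadicRoots} = ⋃ z ∈ dyadicRoots, {z} := by ext; simp
  rw [this, measure_biUnion_null_iff countable_dyadicRoots]
  exact fun z _ => hD.mconv_singleton hσ z

theorem SameType.continuousPart {τ τ' : Measure Circle} (h : SameType τ τ') :
    SameType (continuousPart τ) (continuousPart τ') := by
  have hset : {z | τ {z} = 0} = {z | τ' {z} = 0} := by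
    ext z; exact ⟨fun hz => h.2 hz, fun hz => h.1 hz⟩
  rw [ThueMorse.continuousPart, ThueMorse.continuousPart, hset]
  exact ⟨h.1.restrict _, h.2.restrict _⟩

end

/-! ### Recognizability of the Thue-Morse subshift -/

/-- The binary digits of q and l are concatenated without carry, so the parities add. -/
theorem seq_two_pow_mul_add (n q l : ℕ) (hl : l < 2 ^ n) :
    seq (2 ^ n * q + l) = (seq q ^^ seq l) := by
  induction n generalizing l with
  | zero =>
    obtain rfl : l = 0 := by simpa using hl
    simp [seq_zero]
  | succ n ih =>
    rw [pow_succ] at hl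
    rcases Nat.even_or_odd' l with ⟨m, rfl | rfl⟩
    · rw [show 2 ^ (n + 1) * q + 2 * m = 2 * (2 ^ n * q + m) by ring, seq_two_mul, seq_two_mul,
        ih m (by omega)]
    · rw [show 2 ^ (n + 1) * q + (2 * m + 1) = 2 * (2 ^ n * q + m) + 1 by ring,
        seq_two_mul_add_one, seq_two_mul_add_one, ih m (by omega)]
      simp

/-- The sequences which are concatenations of the two Thue-Morse blocks of length `2 ^ n`, where the
coordinate `0` has position `j` modulo `2 ^ n` in its block. -/
def phaseSet (n : ℕ) (j : ℤ) : Set (ℤ → Bool) :=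
  {y | ∀ (i : ℤ) (l : ℕ), l < 2 ^ n → y (2 ^ n * i - j + l) = (y (2 ^ n * i - j) ^^ seq l)}

theorem shift_apply (m : ℤ) (y : ℤ → Bool) (i : ℤ) : shift m y i = y (i + m) := rfl

theorem shift_mem_phaseSet_iff {n : ℕ} {j m : ℤ} {y : ℤ → Bool} :
    shift m y ∈ phaseSet n j ↔ y ∈ phaseSet n (j - m) := by
  refine forall_congr' fun i => forall_congr' fun l => imp_congr_right fun _ => ?_
  rw [shift_apply, shift_apply, show 2 ^ n * i - j + l + m = 2 ^ n * i - (j - m) + l by ring,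
    show 2 ^ n * i - j + m = 2 ^ n * i - (j - m) by ring]

theorem phaseSet_add_mul (n : ℕ) (j t : ℤ) : phaseSet n (j + 2 ^ n * t) = phaseSet n j := by
  have key (j t : ℤ) : phaseSet n j ⊆ phaseSet n (j + 2 ^ n * t) := fun y hy i l hl => by
    rw [show 2 ^ n * i - (j + 2 ^ n * t) = 2 ^ n * (i - t) - j by ring]
    exact hy _ l hl
  refine Set.Subset.antisymm ?_ (key j t)
  have := key (j + 2 ^ n * t) (-t)
  rwa [show j + 2 ^ n * t + 2 ^ n * -t = j by ring] at this

theorem phaseSet_succ_subset (n : ℕ) (j : ℤ) : phaseSet (n + 1) j ⊆ phaseSet n j := by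
  intro y hy i l hl
  have hp : 2 ^ (n + 1) = 2 * 2 ^ n := pow_succ' 2 n
  obtain ⟨m, rfl | rfl⟩ := Int.even_or_odd' i
  · have := hy m l (by omega)
    rwa [show (2 : ℤ) ^ (n + 1) * m = 2 ^ n * (2 * m) by ring] at this
  · have h1 := hy m (2 ^ n + l) (by omega)
    have h2 := hy m (2 ^ n) (by have := Nat.two_pow_pos n; omega)
    have h3 := seq_two_pow_add n 0 (Nat.two_pow_pos n)
    rw [add_zero, seq_zero] at h3
    rw [seq_two_pow_add n l hl] at h1
    rw [h3] at h2
    push_cast at h1 h2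
    rw [show (2 : ℤ) ^ n * (2 * m + 1) - j + l = 2 ^ (n + 1) * m - j + (2 ^ n + l) by ring, h1,
      show (2 : ℤ) ^ n * (2 * m + 1) - j = 2 ^ (n + 1) * m - j + 2 ^ n by ring, h2]
    simp

theorem phaseSet_antitone (j : ℤ) : Antitone fun n => phaseSet n j :=
  antitone_nat_of_succ_le fun n => phaseSet_succ_subset n j

theorem shift_mem_subshift {y : ℤ → Bool} (hy : y ∈ subshift) (m : ℤ) : shift m y ∈ subshift := by
  intro i n
  obtain ⟨j, hj⟩ := hy (i + m) n
  exact ⟨j, fun l hl => by rw [shift_apply, ← hj l hl]; congr 1; ring⟩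

/-- If all 2^n phases failed, the failures would be visible in one finite window. But that window is
a block of `seq`, which respects the phase of its own position. -/
theorem exists_mem_phaseSet {y : ℤ → Bool} (hy : y ∈ subshift) (n : ℕ) :
    ∃ j : ℕ, j < 2 ^ n ∧ y ∈ phaseSet n j := by
  by_contra! hcon
  have h1 (j : ℕ) : ∃ M : ℕ, j < 2 ^ n → ∃ (i : ℤ) (l : ℕ), l < 2 ^ n ∧
      -(M : ℤ) ≤ 2 ^ n * i - j ∧ 2 ^ n * i - j + 2 ^ n ≤ M ∧
      y (2 ^ n * i - j + l) ≠ (y (2 ^ n * i - j) ^^ seq l) := by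
    by_cases hj : j < 2 ^ n
    · have := hcon j hj
      simp only [phaseSet, Set.mem_ofPred_eq, not_forall] at this
      obtain ⟨i, l, hl, hne⟩ := this
      refine ⟨(2 ^ n * i - j).natAbs + 2 ^ n, fun _ => ⟨i, l, hl, ?_, ?_, hne⟩⟩
      · push_cast
        have := neg_abs_le (2 ^ n * i - (j : ℤ))
        have h2 : (0 : ℤ) < 2 ^ n := by positivity
        linarith
      · push_cast
        have := le_abs_self (2 ^ n * i - (j : ℤ))
        linarith
    · exact ⟨0, fun h => absurd h hj⟩
  choose M hM using h1
  set K := ∑ j ∈ Finset.range (2 ^ n), M j with hK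
  obtain ⟨J, hJ⟩ := hy (-(K : ℤ)) (2 * K)
  -- The window starts at coordinate -K and index J, so coordinate 0 corresponds to index J + K.
  have hlt : (J + K) % 2 ^ n < 2 ^ n := Nat.mod_lt _ (by positivity)
  obtain ⟨i, l, hl, hi1, hi2, hne⟩ := hM _ hlt
  have hMK : M ((J + K) % 2 ^ n) ≤ K :=
    Finset.single_le_sum (f := M) (fun _ _ => Nat.zero_le _) (Finset.mem_range.2 hlt)
  have hMK' : (M ((J + K) % 2 ^ n) : ℤ) ≤ K := by exact_mod_cast hMK
  have hdiv := Nat.div_add_mod (J + K) (2 ^ n)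
  set r := (J + K) % 2 ^ n
  set u := (J + K) / 2 ^ n
  have hp : (0 : ℤ) < 2 ^ n := by positivity
  have hdiv' : (2 : ℤ) ^ n * u + r = J + K := by exact_mod_cast hdiv
  obtain ⟨w, hw⟩ : ∃ w : ℕ, (2 : ℤ) ^ n * i - r + K = w := ⟨(2 ^ n * i - r + K).toNat, by omega⟩
  have hl' : (l : ℤ) < 2 ^ n := by exact_mod_cast hl
  have hval (t : ℕ) (ht : t < 2 ^ n) : y (2 ^ n * i - r + t) = seq (J + (w + t)) := by
    have ht' : (t : ℤ) < 2 ^ n := by exact_mod_cast ht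
    rw [← hJ (w + t) (by omega)]
    congr 1; push_cast; linarith
  have hq0 : 0 ≤ i + u := by
    by_contra! h
    have : (2 : ℤ) ^ n * (i + u) ≤ 2 ^ n * (-1) := by gcongr; omega
    nlinarith
  obtain ⟨q, hq⟩ := Int.eq_ofNat_of_zero_le hq0
  have hJw (t : ℕ) : J + (w + t) = 2 ^ n * q + t := by
    have : (J : ℤ) + (w + t) = 2 ^ n * q + t := by
      rw [← hw, ← hq]; linarith
    exact_mod_cast this
  apply hne
  have h0 := hval 0 (by positivity)
  rw [Nat.cast_zero, add_zero, hJw, add_zero] at h0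
  have h0' := seq_two_pow_mul_add n q 0 (by positivity)
  rw [add_zero, seq_zero, Bool.xor_false] at h0'
  rw [hval l hl, hJw, h0, seq_two_pow_mul_add n q l hl, h0']

/-- The symbols at 4w+1 and 4w+2 agree, both being the complement of the symbol at w. -/
theorem exists_seq_eq_succ (q : ℕ) : ∃ i < 4, seq (q + i) = seq (q + (i + 1)) := by
  obtain ⟨i, w, hi, h⟩ : ∃ i w : ℕ, i < 4 ∧ q + i = 4 * w + 1 :=
    ⟨(5 - q % 4) % 4, (q + (5 - q % 4) % 4) / 4, by omega, by omega⟩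
  refine ⟨i, hi, ?_⟩
  rw [← add_assoc, h, show 4 * w + 1 + 1 = 2 * (2 * w + 1) by ring,
    show 4 * w + 1 = 2 * (2 * w) + 1 by ring, seq_two_mul_add_one, seq_two_mul, seq_two_mul,
    seq_two_mul_add_one]

/-- Two phases half a block apart would make the starting symbols of all consecutive blocks of
length 2^n alternate. Sampled with step 2^n, however, y shows five consecutive terms of `seq` up to
complement, among which two neighbours agree. -/
theorem disjoint_phaseSet_succ {y : ℤ → Bool} (hy : y ∈ subshift) {n : ℕ} {j : ℤ}
    (h : y ∈ phaseSet (n + 1) j) (h' : y ∈ phaseSet (n + 1) (j + 2 ^ n)) : False := by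
  have hlt : 2 ^ n < 2 ^ (n + 1) := Nat.pow_lt_pow_right (by norm_num) (Nat.lt_succ_self n)
  have h3 := seq_two_pow_add n 0 (Nat.two_pow_pos n)
  rw [add_zero, seq_zero] at h3
  have halt (i : ℤ) : y (2 ^ n * (i + 1) - j) = !y (2 ^ n * i - j) := by
    obtain ⟨m, rfl | rfl⟩ := Int.even_or_odd' i
    · have := h m (2 ^ n) hlt
      rw [h3] at this
      push_cast at this
      rw [show (2 : ℤ) ^ n * (2 * m + 1) - j = 2 ^ (n + 1) * m - j + 2 ^ n by ring, this,
        show (2 : ℤ) ^ n * (2 * m) - j = 2 ^ (n + 1) * m - j by ring]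
      simp
    · have := h' (m + 1) (2 ^ n) hlt
      rw [h3] at this
      push_cast at this
      rw [show (2 : ℤ) ^ n * (2 * m + 1 + 1) - j =
          2 ^ (n + 1) * (m + 1) - (j + 2 ^ n) + 2 ^ n by ring, this,
        show (2 : ℤ) ^ n * (2 * m + 1) - j = 2 ^ (n + 1) * (m + 1) - (j + 2 ^ n) by ring]
      simp
  obtain ⟨J, hJ⟩ := hy (-j) (2 ^ n * 5)
  have hp : 0 < 2 ^ n := by positivity
  have hr := Nat.mod_lt J hp
  have hdiv := Nat.div_add_mod J (2 ^ n)
  set r := J % 2 ^ n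
  set u := J / 2 ^ n
  have hval (i : ℕ) (hi : i < 5) : y (2 ^ n * i - j) = (seq (u + i) ^^ seq r) := by
    rw [← seq_two_pow_mul_add n (u + i) r hr,
      show 2 ^ n * (u + i) + r = J + 2 ^ n * i by rw [← hdiv]; ring,
      ← hJ (2 ^ n * i) (Nat.mul_lt_mul_of_pos_left hi hp)]
    congr 1; push_cast; ring
  obtain ⟨i, hi, heq⟩ := exists_seq_eq_succ u
  have h4 := halt i
  have h5 := hval (i + 1) (by omega)
  push_cast at h5
  rw [h5, hval i (by omega), heq] at h4
  simp at h4

theorem dvd_sub_of_mem_phaseSet {y : ℤ → Bool} (hy : y ∈ subshift) (n : ℕ) {j j' : ℤ}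
    (h : y ∈ phaseSet n j) (h' : y ∈ phaseSet n j') : (2 : ℤ) ^ n ∣ j' - j := by
  induction n with
  | zero => simp
  | succ n ih =>
    obtain ⟨t, ht⟩ := ih (phaseSet_succ_subset n j h) (phaseSet_succ_subset n j' h')
    obtain ⟨s, rfl | rfl⟩ := Int.even_or_odd' t
    · exact ⟨s, by rw [ht]; ring⟩
    · refine (disjoint_phaseSet_succ hy h ?_).elim
      rw [← phaseSet_add_mul (n + 1) _ s]
      convert h' using 2
      linear_combination -ht

/-- Within a block the sequence is determined by the phase and the coordinate `0`. -/
theorem apply_eq_of_mem_phaseSet {y : ℤ → Bool} {n j : ℕ} (hj : j < 2 ^ n)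
    (h : y ∈ phaseSet n j) {i : ℤ} (h0 : 0 ≤ i + j) (h1 : i + j < 2 ^ n) :
    y i = (y 0 ^^ seq j ^^ seq (i + j).toNat) := by
  have h2 := h 0 j hj
  have h3 := h 0 (i + j).toNat (by zify; rw [Int.toNat_of_nonneg h0]; exact h1)
  rw [Int.toNat_of_nonneg h0] at h3
  rw [mul_zero, zero_sub, neg_add_cancel] at h2
  rw [mul_zero, zero_sub, neg_add_cancel_comm_assoc] at h3
  rw [h3, h2]
  simp

theorem measurableSet_phaseSet (n : ℕ) (j : ℤ) : MeasurableSet (phaseSet n j) := by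
  have : phaseSet n j = ⋂ (i : ℤ) (l : ℕ) (_ : l < 2 ^ n),
      {y | y (2 ^ n * i - j + l) = (y (2 ^ n * i - j) ^^ seq l)} := by
    ext y; simp [phaseSet]
  rw [this]
  refine MeasurableSet.iInter fun i => MeasurableSet.iInter fun l => MeasurableSet.iInter fun _ => ?_
  refine measurableSet_eq_fun (measurable_pi_apply _) ?_
  exact (Measurable.of_discrete (f := fun b : Bool => (b ^^ seq l))).comp (measurable_pi_apply _)

/-! ### Invariant measures on the subshift -/

theorem measurable_shift (m : ℤ) : Measurable (shift m) :=
  measurable_pi_lambda _ fun i => measurable_pi_apply (i + m)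

section InvariantMeasure

variable {μ : Measure (ℤ → Bool)}

theorem measurePreserving_shift (h : MeasurePreserving (shift 1) μ μ) (m : ℤ) :
    MeasurePreserving (shift m) μ μ := by
  have hcomp (a b : ℤ) : shift a ∘ shift b = shift (a + b) := funext fun y => (shift_add a b y).symm
  have hneg : MeasurePreserving (shift (-1)) μ μ := by
    refine ⟨measurable_shift _, ?_⟩
    conv_lhs => rw [← h.map_eq]
    rw [Measure.map_map (measurable_shift _) (measurable_shift _), hcomp]
    have : shift (-1 + 1) = id := funext fun y => by simpa using shift_zero y
    rw [this, Measure.map_id]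
  induction m with
  | zero =>
    have : shift 0 = id := funext shift_zero
    rw [this]; exact MeasurePreserving.id μ
  | succ m ih =>
    rw [← hcomp]; exact ih.comp h
  | pred m ih =>
    rw [sub_eq_add_neg, ← hcomp]; exact ih.comp hneg

theorem IsSubshiftMeasure.measurePreserving_shift (h : IsSubshiftMeasure μ) (m : ℤ) :
    MeasurePreserving (shift m) μ μ :=
  ThueMorse.measurePreserving_shift h.invariant m

theorem IsSubshiftMeasure.measure_phaseSet_eq (h : IsSubshiftMeasure μ) (n : ℕ) (j : ℤ) :
    μ (phaseSet n j) = μ (phaseSet n 0) := by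
  rw [← (h.measurePreserving_shift j).measure_preimage
    (measurableSet_phaseSet n j).nullMeasurableSet]
  congr 1; ext y
  rw [Set.mem_preimage, shift_mem_phaseSet_iff, sub_self]

theorem sum_indicator_phaseSet {M : Type*} [AddCommMonoid M] {y : ℤ → Bool} (hy : y ∈ subshift)
    {n j : ℕ} (hj : j < 2 ^ n) (hmem : y ∈ phaseSet n j) (f : ℕ → M) :
    ∑ k ∈ Finset.range (2 ^ n), (phaseSet n k).indicator (fun _ => f k) y = f j := by
  rw [Finset.sum_eq_single j]
  · exact Set.indicator_of_mem hmem _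
  · intro k hk hkj
    refine Set.indicator_of_notMem (fun hk' => hkj ?_) _
    obtain ⟨t, ht⟩ := dvd_sub_of_mem_phaseSet hy n hmem hk'
    rw [Finset.mem_range] at hk
    have h1 : (k : ℤ) < 2 ^ n := by exact_mod_cast hk
    have h2 : (j : ℤ) < 2 ^ n := by exact_mod_cast hj
    have h3 : (k : ℤ) - j = 0 := by
      refine Int.eq_zero_of_abs_lt_dvd (m := 2 ^ n) ⟨t, ht⟩ ?_
      rw [abs_lt]; constructor <;> omega
    omega
  · intro hj'
    exact absurd (Finset.mem_range.2 hj) hj'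

/-- The 2^n phases partition the subshift and are permuted by the shift. -/
theorem IsSubshiftMeasure.measure_phaseSet (h : IsSubshiftMeasure μ) (n : ℕ) (j : ℤ) :
    μ (phaseSet n j) = (2 ^ n)⁻¹ := by
  have := h.prob
  have h1 : ∑ k ∈ Finset.range (2 ^ n), μ (phaseSet n k) = 1 := by
    have h2 : ∀ᵐ y ∂μ, ∑ k ∈ Finset.range (2 ^ n),
        (phaseSet n k).indicator (fun _ => (1 : ENNReal)) y = 1 := by
      filter_upwards [h.carried] with y hy
      obtain ⟨j, hj, hmem⟩ := exists_mem_phaseSet hy n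
      exact sum_indicator_phaseSet hy hj hmem fun _ => 1
    have h3 := lintegral_congr_ae h2
    rw [lintegral_finsetSum (Finset.range (2 ^ n))
      (f := fun (k : ℕ) y => (phaseSet n k).indicator (fun _ => (1 : ENNReal)) y)
      fun k _ => measurable_const.indicator (measurableSet_phaseSet n k)] at h3
    simpa [lintegral_indicator (measurableSet_phaseSet n _)] using h3
  simp only [h.measure_phaseSet_eq n (_ : ℕ), Finset.sum_const, Finset.card_range,
    nsmul_eq_mul] at h1
  rw [h.measure_phaseSet_eq]
  push_cast at h1
  rw [mul_comm] at h1
  exact ENNReal.eq_inv_of_mul_eq_one_left h1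

/-- A point with phase k at every level has a block boundary at -k at every level. Excluding these
points makes the blocks around 0 exhaust ℤ. -/
theorem IsSubshiftMeasure.ae_eventually_notMem_phaseSet (h : IsSubshiftMeasure μ) :
    ∀ᵐ y ∂μ, ∀ k : ℤ, ∃ n, y ∉ phaseSet n k := by
  rw [ae_all_iff]
  intro k
  rw [ae_iff]
  simp only [not_exists, not_not]
  have h1 (n : ℕ) : μ {y | ∀ n, y ∈ phaseSet n k} ≤ (2⁻¹ : ENNReal) ^ n := by
    rw [← ENNReal.inv_pow, ← h.measure_phaseSet n k]
    exact measure_mono fun y hy => hy n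
  refine le_antisymm (ge_of_tendsto' (ENNReal.tendsto_pow_atTop_nhds_zero_of_lt_one ?_) h1)
    (zero_le)
  exact ENNReal.one_half_lt_one

/-- The eigenfunction with eigenvalue `ζ`, where `ζ ^ (2 ^ n) = 1`. -/
noncomputable def phaseFun (n : ℕ) (ζ : Circle) (y : ℤ → Bool) : ℂ :=
  ∑ k ∈ Finset.range (2 ^ n), (phaseSet n k).indicator (fun _ => (ζ : ℂ) ^ k) y

/-- The sign of the coordinate `0`. -/
noncomputable def coordSign (y : ℤ → Bool) : ℂ := if y 0 then -1 else 1

theorem measurable_phaseFun (n : ℕ) (ζ : Circle) : Measurable (phaseFun n ζ) := by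
  unfold phaseFun
  exact Finset.measurable_fun_sum _ fun k _ =>
    measurable_const.indicator (measurableSet_phaseSet n k)

theorem measurable_coordSign : Measurable coordSign :=
  (Measurable.of_discrete (f := fun b : Bool => if b then (-1 : ℂ) else 1)).comp
    (measurable_pi_apply 0)

theorem phaseFun_eq {y : ℤ → Bool} (hy : y ∈ subshift) {n : ℕ} {ζ : Circle}
    (hζ : ζ ^ (2 ^ n) = 1) {j : ℤ} (hj : y ∈ phaseSet n j) : phaseFun n ζ y = (ζ : ℂ) ^ j := by
  obtain ⟨i, hi, hmem⟩ := exists_mem_phaseSet hy n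
  rw [phaseFun, sum_indicator_phaseSet hy hi hmem fun k => (ζ : ℂ) ^ k]
  obtain ⟨t, ht⟩ := dvd_sub_of_mem_phaseSet hy n hmem hj
  have h1 : j = 2 ^ n * t + i := by linarith
  have h2 : (ζ : ℂ) ^ (2 ^ n) = 1 := by rw [← Circle.coe_pow, hζ, Circle.coe_one]
  have h3 : (ζ : ℂ) ^ ((2 : ℤ) ^ n) = 1 := by rw [← h2]; exact_mod_cast zpow_natCast (ζ : ℂ) (2 ^ n)
  rw [h1, zpow_add₀ ζ.coe_ne_zero, zpow_mul, h3, one_zpow, one_mul, zpow_natCast]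

theorem phaseFun_shift {y : ℤ → Bool} (hy : y ∈ subshift) {n : ℕ} {ζ : Circle}
    (hζ : ζ ^ (2 ^ n) = 1) (m : ℤ) :
    phaseFun n ζ (shift m y) = (ζ : ℂ) ^ m * phaseFun n ζ y := by
  obtain ⟨i, hi, hmem⟩ := exists_mem_phaseSet hy n
  rw [phaseFun_eq hy hζ hmem, phaseFun_eq (shift_mem_subshift hy m) hζ (j := i + m)
    (shift_mem_phaseSet_iff.2 (by rwa [add_sub_cancel_right])), zpow_add₀ ζ.coe_ne_zero, mul_comm]

theorem phaseFun_mul_conj {y : ℤ → Bool} (hy : y ∈ subshift) {n : ℕ} {ζ : Circle}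
    (hζ : ζ ^ (2 ^ n) = 1) : phaseFun n ζ y * (starRingEnd ℂ) (phaseFun n ζ y) = 1 := by
  obtain ⟨i, hi, hmem⟩ := exists_mem_phaseSet hy n
  rw [phaseFun_eq hy hζ hmem, Complex.mul_conj', norm_zpow, Circle.norm_coe]
  simp

theorem norm_phaseFun {y : ℤ → Bool} (hy : y ∈ subshift) {n : ℕ} {ζ : Circle}
    (hζ : ζ ^ (2 ^ n) = 1) : ‖phaseFun n ζ y‖ = 1 := by
  obtain ⟨i, hi, hmem⟩ := exists_mem_phaseSet hy n
  rw [phaseFun_eq hy hζ hmem, norm_zpow, Circle.norm_coe, one_zpow]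

theorem norm_coordSign (y : ℤ → Bool) : ‖coordSign y‖ = 1 := by
  unfold coordSign; split_ifs <;> simp

theorem conj_coordSign (y : ℤ → Bool) : (starRingEnd ℂ) (coordSign y) = coordSign y := by
  unfold coordSign; split_ifs <;> simp

theorem memLp_phaseFun (h : IsSubshiftMeasure μ) {n : ℕ} {ζ : Circle} (hζ : ζ ^ (2 ^ n) = 1) :
    MemLp (phaseFun n ζ) 2 μ := by
  have := h.prob
  refine MemLp.of_bound (measurable_phaseFun n ζ).aestronglyMeasurable 1 ?_
  filter_upwards [h.carried] with y hy
  exact (norm_phaseFun hy hζ).le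

theorem memLp_phaseFun_mul_coordSign (h : IsSubshiftMeasure μ) {n : ℕ} {ζ : Circle}
    (hζ : ζ ^ (2 ^ n) = 1) : MemLp (fun y => phaseFun n ζ y * coordSign y) 2 μ := by
  have := h.prob
  refine MemLp.of_bound
    ((measurable_phaseFun n ζ).mul measurable_coordSign).aestronglyMeasurable 1 ?_
  filter_upwards [h.carried] with y hy
  rw [norm_mul, norm_phaseFun hy hζ, norm_coordSign, one_mul]

theorem coordSign_shift_eq {y : ℤ → Bool} {i : ℤ} {j : ℕ} (h : y i = seq j) :
    coordSign (shift i y) = sgn j := by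
  simp only [coordSign, shift_apply, zero_add, h, sgn]
  split_ifs <;> simp

theorem integrable_coordSign_mul (h : IsSubshiftMeasure μ) (a b : ℤ) :
    Integrable (fun y => coordSign (shift a y) * coordSign (shift b y)) μ := by
  have := h.prob
  refine Integrable.of_bound (((measurable_coordSign.comp (measurable_shift a)).mul
    (measurable_coordSign.comp (measurable_shift b))).aestronglyMeasurable) 1 ?_
  filter_upwards with y
  rw [norm_mul, norm_coordSign, norm_coordSign, one_mul]

theorem integral_coordSign_shift (h : IsSubshiftMeasure μ) (a b c : ℤ) :
    ∫ y, coordSign (shift (a + c) y) * coordSign (shift (b + c) y) ∂μ =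
      ∫ y, coordSign (shift a y) * coordSign (shift b y) ∂μ := by
  have h1 := integral_map (μ := μ) (measurable_shift c).aemeasurable
    (f := fun y => coordSign (shift a y) * coordSign (shift b y))
    (((measurable_coordSign.comp (measurable_shift a)).mul
    (measurable_coordSign.comp (measurable_shift b))).aestronglyMeasurable)
  rw [(h.measurePreserving_shift c).map_eq] at h1
  rw [h1]
  simp only [← shift_add]

/-- By invariance the integral equals that of an average over N shifts. At each point of the
subshift this average is a correlation over some window of `seq`, and the error is bounded uniformly
over windows; no ergodic theorem is needed. -/
theorem integral_coordSign_mul_nat (h : IsSubshiftMeasure μ) (k : ℕ) :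
    ∫ y, coordSign (shift k y) * coordSign (shift 0 y) ∂μ = eta k := by
  have := h.prob
  obtain ⟨e, he, hbound⟩ := exists_tendsto_zero_abs_corrErr_div_le k
  rw [← sub_eq_zero, ← norm_le_zero_iff]
  refine ge_of_tendsto he ?_
  filter_upwards [eventually_gt_atTop 0] with N hN
  have hN0 : (N : ℂ) ≠ 0 := by exact_mod_cast hN.ne'
  have h1 : ∫ y, coordSign (shift k y) * coordSign (shift 0 y) ∂μ - eta k =
      ∫ y, ((N : ℂ)⁻¹ * (∑ n ∈ Finset.range N,
        coordSign (shift (k + n) y) * coordSign (shift (0 + n) y)) - eta k) ∂μ := by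
    rw [integral_sub ((integrable_finsetSum _ fun n _ =>
        integrable_coordSign_mul h _ _).const_mul _) (integrable_const _),
      integral_const_mul, integral_finsetSum _ fun n _ => integrable_coordSign_mul h _ _]
    simp only [integral_coordSign_shift h k 0]
    simp [inv_mul_cancel_left₀ hN0]
  rw [h1]
  have h2 : ∀ᵐ y ∂μ, ‖(N : ℂ)⁻¹ * (∑ n ∈ Finset.range N,
        coordSign (shift (k + n) y) * coordSign (shift (0 + n) y)) - eta k‖ ≤ e N := by
    filter_upwards [h.carried] with y hy
    obtain ⟨j, hj⟩ := hy 0 (N + k)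
    have hval (n : ℕ) (hn : n < N + k) : coordSign (shift n y) = sgn (j + n) :=
      coordSign_shift_eq (by rw [← hj n hn, zero_add])
    have h3 : ∑ n ∈ Finset.range N, coordSign (shift (k + n) y) * coordSign (shift (0 + n) y) =
        ((corrSum k (j + N) - corrSum k j : ℝ) : ℂ) := by
      rw [corrSum, corrSum, Finset.sum_range_add_sub_sum_range]
      push_cast
      refine Finset.sum_congr rfl fun n hn => ?_
      rw [Finset.mem_range] at hn
      have h4 := hval (k + n) (by omega)
      push_cast at h4
      rw [h4, zero_add, hval n (by omega), show j + (k + n) = j + n + k by ring]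
    have h5 : (N : ℂ)⁻¹ * ((corrSum k (j + N) - corrSum k j : ℝ) : ℂ) - eta k =
        ((corrErr k j N / N : ℝ) : ℂ) := by
      rw [corrErr]; push_cast; field_simp
    rw [h3, h5, Complex.norm_real, Real.norm_eq_abs, abs_div, Nat.abs_cast]
    exact hbound j N
  refine (norm_integral_le_of_norm_le_const h2).trans ?_
  simp

theorem integral_coordSign_mul (h : IsSubshiftMeasure μ) (m : ℤ) :
    ∫ y, coordSign (shift m y) * coordSign y ∂μ = etaInt m := by
  obtain ⟨k, rfl | rfl⟩ := m.eq_nat_or_neg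
  · rw [etaInt_natCast, ← integral_coordSign_mul_nat h k]
    simp only [shift_zero]
  · rw [etaInt_neg, etaInt_natCast, ← integral_coordSign_mul_nat h k,
      ← integral_coordSign_shift h k 0 (-k)]
    simp only [add_neg_cancel, zero_add, shift_zero]
    congr 1; ext y; ring

theorem isSpectralMeasureOf_phaseFun (h : IsSubshiftMeasure μ) {n : ℕ} {ζ : Circle}
    (hζ : ζ ^ (2 ^ n) = 1) : IsSpectralMeasureOf μ (phaseFun n ζ) (Measure.dirac ζ) := by
  have := h.prob
  refine ⟨inferInstance, fun m => ?_⟩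
  rw [integral_dirac]
  have h1 : ∀ᵐ y ∂μ, phaseFun n ζ (shift m y) * (starRingEnd ℂ) (phaseFun n ζ y) =
      (ζ : ℂ) ^ m := by
    filter_upwards [h.carried] with y hy
    rw [phaseFun_shift hy hζ, mul_assoc, phaseFun_mul_conj hy hζ, mul_one]
  rw [integral_congr_ae h1]
  simp

/-- A unimodular eigenfunction factor multiplies the m-th correlation by ζ^m, which rotates the
spectral measure by ζ. -/
theorem isSpectralMeasureOf_phaseFun_mul_coordSign (h : IsSubshiftMeasure μ) {σ : Measure Circle}
    (hσ : IsSpectralMeasureOfSeq σ) {n : ℕ} {ζ : Circle} (hζ : ζ ^ (2 ^ n) = 1) :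
    IsSpectralMeasureOf μ (fun y => phaseFun n ζ y * coordSign y) (σ.map fun z => ζ * z) := by
  have := h.prob
  have := hσ.finite
  refine ⟨inferInstance, fun m => ?_⟩
  have h1 : ∀ᵐ y ∂μ, phaseFun n ζ (shift m y) * coordSign (shift m y) *
      (starRingEnd ℂ) (phaseFun n ζ y * coordSign y) =
      (ζ : ℂ) ^ m * (coordSign (shift m y) * coordSign y) := by
    filter_upwards [h.carried] with y hy
    rw [phaseFun_shift hy hζ, map_mul, conj_coordSign]
    linear_combination ((ζ : ℂ) ^ m * (coordSign (shift m y) * coordSign y)) *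
      phaseFun_mul_conj hy hζ
  rw [integral_congr_ae h1, integral_const_mul, integral_coordSign_mul h,
    integral_map (measurable_mul_left_circle ζ).aemeasurable
      (measurable_zpow m).aestronglyMeasurable]
  simp only [Circle.coe_mul, mul_zpow]
  rw [integral_const_mul, hσ.integral_zpow]

end InvariantMeasure

/-! ### Domination of spectral measures by those of a total set -/

section Spectral

variable {H : Type*} [NormedAddCommGroup H] [InnerProductSpace ℂ H] {V : ℤ → H →ₗᵢ[ℂ] H}

theorem inner_map_map_eq (hV : ∀ m n x, V (m + n) x = V m (V n x)) (m n : ℤ) (x y : H) :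
    inner ℂ (V m x) (V n y) = inner ℂ x (V (n - m) y) := by
  rw [show n = m + (n - m) by ring, hV, LinearIsometry.inner_map_map, add_sub_cancel_left]

/-- The spectral isometry on trigonometric polynomials. The exponents `e` cover both the powers i
and -i. -/
theorem norm_sum_smul_map_sq (hV : ∀ m n x, V (m + n) x = V m (V n x)) {x : H}
    {ρ : Measure Circle} [IsFiniteMeasure ρ]
    (hρ : ∀ m : ℤ, ∫ z : Circle, (z : ℂ) ^ m ∂ρ = inner ℂ x (V m x))
    (s : Finset ℤ) (a : ℤ → ℂ) (e : ℤ → ℤ) :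
    ‖∑ i ∈ s, a i • V (e i) x‖ ^ 2 = ∫ z : Circle, ‖∑ i ∈ s, a i * (z : ℂ) ^ (e i)‖ ^ 2 ∂ρ := by
  have h1 : ((‖∑ i ∈ s, a i • V (e i) x‖ ^ 2 : ℝ) : ℂ) =
      ((∫ z : Circle, ‖∑ i ∈ s, a i * (z : ℂ) ^ (e i)‖ ^ 2 ∂ρ : ℝ) : ℂ) := by
    have hpt (z : Circle) : ((‖∑ i ∈ s, a i * (z : ℂ) ^ (e i)‖ ^ 2 : ℝ) : ℂ) =
        ∑ i ∈ s, ∑ j ∈ s, (a j * (starRingEnd ℂ) (a i)) * (z : ℂ) ^ (e j - e i) := by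
      rw [Complex.ofReal_pow, ← Complex.conj_mul', map_sum, Finset.sum_mul_sum]
      refine Finset.sum_congr rfl fun i _ => Finset.sum_congr rfl fun j _ => ?_
      rw [map_mul, map_zpow₀, ← Circle.coe_inv_eq_conj, Circle.coe_inv, inv_zpow,
        zpow_sub₀ z.coe_ne_zero]
      ring
    have hI (i j : ℤ) : Integrable (fun z : Circle =>
        (a j * (starRingEnd ℂ) (a i)) * (z : ℂ) ^ (e j - e i)) ρ :=
      (integrable_zpow ρ _).const_mul _
    rw [← integral_complex_ofReal]
    simp only [hpt]
    rw [integral_finsetSum _ fun i _ => integrable_finsetSum _ fun j _ => hI i j,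
      Complex.ofReal_pow]
    change ((‖∑ i ∈ s, a i • V (e i) x‖ : ℝ) : ℂ) ^ 2 = _
    have h3 := inner_self_eq_norm_sq_to_K (𝕜 := ℂ) (∑ i ∈ s, a i • V (e i) x)
    refine h3.symm.trans ?_
    rw [sum_inner]
    refine Finset.sum_congr rfl fun i _ => ?_
    rw [inner_sum, integral_finsetSum _ fun j _ => hI i j]
    refine Finset.sum_congr rfl fun j _ => ?_
    rw [inner_smul_left, inner_smul_right, inner_map_map_eq hV, integral_const_mul, hρ]
    ring
  exact_mod_cast h1

/-- The polynomial is moved to the other vector by adjunction. `V 0` is not assumed to be the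
identity; only the norm of `V 0 x` will enter. -/
theorem inner_sum_smul_map (hV : ∀ m n x, V (m + n) x = V m (V n x)) (x y : H)
    (s : Finset ℤ) (a : ℤ → ℂ) :
    inner ℂ y (∑ i ∈ s, a i • V i x) =
      inner ℂ (∑ i ∈ s, (starRingEnd ℂ) (a i) • V (-i) y) (V 0 x) := by
  rw [inner_sum, sum_inner]
  refine Finset.sum_congr rfl fun i _ => ?_
  rw [inner_smul_right, inner_smul_left, inner_map_map_eq hV, Complex.conj_conj]
  simp

theorem norm_trig_conj (c : ℤ →₀ ℂ) (z : Circle) :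
    ‖∑ i ∈ c.support, (starRingEnd ℂ) (c i) * (z : ℂ) ^ (-i)‖ = ‖trig c z‖ := by
  rw [trig_apply, ← Complex.norm_conj (∑ i ∈ c.support, c i * (z : ℂ) ^ i), map_sum]
  congr 1
  refine Finset.sum_congr rfl fun i _ => ?_
  rw [map_mul, map_zpow₀, ← Circle.coe_inv_eq_conj, Circle.coe_inv, inv_zpow, zpow_neg]

/-- Bounded pointwise approximation of the indicator of a closed set by trigonometric
polynomials. -/
theorem exists_trig_tendsto_indicator {E : Set Circle} (hE : IsClosed E) :
    ∃ c : ℕ → ℤ →₀ ℂ, (∀ n z, ‖trig (c n) z‖ ≤ 2) ∧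
      ∀ z, Tendsto (fun n => trig (c n) z) atTop (𝓝 (E.indicator 1 z)) := by
  have hδ (n : ℕ) : (0 : ℝ) < 1 / ((n : ℝ) + 1) := by positivity
  set φ : ℕ → C(Circle, ℂ) := fun n =>
    ⟨fun z => ((thickenedIndicator (hδ n) E z : ℝ) : ℂ), by
      have := (thickenedIndicator (hδ n) E).continuous
      fun_prop⟩ with hφ
  choose c hc using fun n => exists_trig_approx (φ n) (hδ n)
  have hlim := thickenedIndicator_tendsto_indicator_closure hδ
    tendsto_one_div_add_atTop_nhds_zero_nat E
  rw [hE.closure_eq, tendsto_pi_nhds] at hlim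
  refine ⟨c, fun n z => ?_, fun z => ?_⟩
  · have h1 : ‖φ n z‖ ≤ 1 := by
      change ‖((thickenedIndicator (hδ n) E z : ℝ) : ℂ)‖ ≤ 1
      rw [Complex.norm_real, NNReal.norm_eq]
      exact_mod_cast thickenedIndicator_le_one (hδ n) E z
    have h2 : (1 : ℝ) / (n + 1) ≤ 1 := by
      rw [div_le_one (by positivity)]
      have : (0 : ℝ) ≤ n := Nat.cast_nonneg n
      linarith
    have h3 := norm_sub_norm_le (trig (c n) z) (φ n z)
    linarith [hc n z]
  · have h1 : Tendsto (fun n => φ n z) atTop (𝓝 (E.indicator 1 z)) := by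
      have h2 := hlim z
      have h3 := (Complex.continuous_ofReal.comp NNReal.continuous_coe).tendsto _ |>.comp h2
      have hv : E.indicator (1 : Circle → ℂ) z =
          (((E.indicator (fun _ => (1 : NNReal)) z : NNReal) : ℝ) : ℂ) := by
        by_cases hz : z ∈ E <;> simp [hz]
      rw [hv]
      exact h3
    have h4 : Tendsto (fun n => trig (c n) z - φ n z) atTop (𝓝 0) :=
      squeeze_zero_norm (fun n => (hc n z).le) tendsto_one_div_add_atTop_nhds_zero_nat
    simpa using h4.add h1

/-- Let p_n be bounded polynomials tending to the indicator of E, and Φ_n = p_n(V)x. Then ⟨x, Φ_n⟩ →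
ρ(E). For y in S, |⟨y, Φ_n⟩| is at most a constant times the L²(ν) norm of p_n, which tends to 0
because ν(E) = 0. As Φ_n is bounded, totality of S gives ⟨x, Φ_n⟩ → 0 too. -/
theorem measure_eq_zero_of_total (hV : ∀ m n x, V (m + n) x = V m (V n x)) {S : Set H}
    (hS : (Submodule.span ℂ S).topologicalClosure = ⊤) {E : Set Circle} (hE : IsClosed E)
    (hSE : ∀ y ∈ S, ∃ ν : Measure Circle, IsFiniteMeasure ν ∧
      (∀ m : ℤ, ∫ z : Circle, (z : ℂ) ^ m ∂ν = inner ℂ y (V m y)) ∧ ν E = 0)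
    {x : H} {ρ : Measure Circle} [IsFiniteMeasure ρ]
    (hρ : ∀ m : ℤ, ∫ z : Circle, (z : ℂ) ^ m ∂ρ = inner ℂ x (V m x)) : ρ E = 0 := by
  obtain ⟨c, hc2, hclim⟩ := exists_trig_tendsto_indicator hE
  set Φ : ℕ → H := fun n => ∑ i ∈ (c n).support, c n i • V i x with hΦ
  have hsq (ν : Measure Circle) [IsFiniteMeasure ν] (hν : ν E = 0) :
      Tendsto (fun n => ∫ z, ‖trig (c n) z‖ ^ 2 ∂ν) atTop (𝓝 0) := by
    have h1 : ∫ z, ‖E.indicator (1 : Circle → ℂ) z‖ ^ 2 ∂ν = 0 := by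
      refine integral_eq_zero_of_ae ?_
      filter_upwards [measure_eq_zero_iff_ae_notMem.1 hν] with z hz
      simp [hz]
    rw [← h1]
    refine tendsto_integral_of_dominated_convergence (fun _ => 4)
      (fun n => ((trig (c n)).continuous.norm.pow 2).aestronglyMeasurable) (integrable_const _)
      (fun n => Eventually.of_forall fun z => ?_) (Eventually.of_forall fun z =>
        ((hclim z).norm.pow 2))
    rw [Real.norm_of_nonneg (by positivity)]
    nlinarith [hc2 n z, norm_nonneg (trig (c n) z)]
  have hSlim : ∀ y ∈ S, Tendsto (fun n => inner ℂ y (Φ n)) atTop (𝓝 (0 : ℂ)) := by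
    intro y hy
    obtain ⟨ν, hfin, hν, hνE⟩ := hSE y hy
    have h1 := ((hsq ν hνE).sqrt).mul_const ‖V 0 x‖
    rw [Real.sqrt_zero, zero_mul] at h1
    refine squeeze_zero_norm (fun n => ?_) h1
    rw [hΦ, inner_sum_smul_map hV]
    refine (norm_inner_le_norm _ _).trans (le_of_eq ?_)
    congr 1
    have h2 := norm_sum_smul_map_sq hV hν (c n).support (fun i => (starRingEnd ℂ) (c n i))
      (fun i => -i)
    simp only [norm_trig_conj] at h2
    rw [← h2, Real.sqrt_sq (norm_nonneg _)]
  have hspan : ∀ y ∈ Submodule.span ℂ S, Tendsto (fun n => inner ℂ y (Φ n)) atTop (𝓝 (0 : ℂ)) := by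
    intro y hy
    induction hy using Submodule.span_induction with
    | mem y hy => exact hSlim y hy
    | zero => simp
    | add y z _ _ h1 h2 => simpa [inner_add_left] using h1.add h2
    | smul a y _ h1 => simpa [inner_smul_left] using h1.mul_const ((starRingEnd ℂ) a)
  have hself : Tendsto (fun n => inner ℂ x (Φ n)) atTop (𝓝 (ρ.real E : ℂ)) := by
    have h1 (n : ℕ) : inner ℂ x (Φ n) = ∫ z, trig (c n) z ∂ρ := by
      simp only [trig_apply, hΦ]
      rw [integral_finsetSum _ fun i _ => (integrable_zpow ρ i).const_mul _, inner_sum]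
      refine Finset.sum_congr rfl fun i _ => ?_
      rw [inner_smul_right, integral_const_mul, hρ]
    have h2 : (ρ.real E : ℂ) = ∫ z, E.indicator (1 : Circle → ℂ) z ∂ρ := by
      rw [integral_indicator hE.measurableSet]
      simp
    simp only [h1]
    rw [h2]
    exact tendsto_integral_of_dominated_convergence (fun _ => 2)
      (fun n => (trig (c n)).continuous.aestronglyMeasurable) (integrable_const _)
      (fun n => Eventually.of_forall fun z => hc2 n z) (Eventually.of_forall hclim)
  have hbound (n : ℕ) : ‖Φ n‖ ≤ Real.sqrt (4 * ρ.real Set.univ) := by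
    refine Real.le_sqrt_of_sq_le ?_
    have h1 := norm_sum_smul_map_sq hV hρ (c n).support (fun i => c n i) (fun i => i)
    simp only [← trig_apply] at h1
    rw [hΦ, h1]
    have h2 : ∫ z, ‖trig (c n) z‖ ^ 2 ∂ρ ≤ ∫ _, (4 : ℝ) ∂ρ := by
      refine integral_mono_of_nonneg (Eventually.of_forall fun z => by positivity)
        (integrable_const _) (Eventually.of_forall fun z => ?_)
      simp only
      nlinarith [hc2 n z, norm_nonneg (trig (c n) z)]
    rw [integral_const, smul_eq_mul, mul_comm] at h2
    exact h2
  set B := Real.sqrt (4 * ρ.real Set.univ)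
  have hB : 0 ≤ B := Real.sqrt_nonneg _
  have hfinal : ρ.real E ≤ 0 := by
    refine le_of_forall_pos_le_add fun ε hε => ?_
    have hx : x ∈ (Submodule.span ℂ S).topologicalClosure := by rw [hS]; trivial
    obtain ⟨y, hy, hxy⟩ := Metric.mem_closure_iff.1 hx (ε / (B + 1)) (by positivity)
    rw [dist_eq_norm] at hxy
    have h1 := (hself.sub (hspan y hy)).norm
    simp only [← inner_sub_left, sub_zero, Complex.norm_real] at h1
    rw [Real.norm_of_nonneg measureReal_nonneg] at h1
    refine le_of_tendsto' h1 fun n => ?_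
    calc ‖inner ℂ (x - y) (Φ n)‖ ≤ ‖x - y‖ * ‖Φ n‖ := norm_inner_le_norm _ _
      _ ≤ (ε / (B + 1)) * (B + 1) := by
          have := hbound n
          gcongr
          linarith
      _ = 0 + ε := by field_simp; ring
  have h0 := le_antisymm hfinal measureReal_nonneg
  rwa [measureReal_eq_zero_iff] at h0

end Spectral

/-! ### Totality of the eigenfunctions and their products with the sign -/

section Totality

variable {μ : Measure (ℤ → Bool)}

/-- The root of unity `exp (2 π i / 2 ^ n)`. -/
noncomputable def dyadicRoot (n : ℕ) : Circle := Circle.exp (2 * Real.pi / (2 ^ n : ℕ))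

theorem isPrimitiveRoot_dyadicRoot (n : ℕ) : IsPrimitiveRoot (dyadicRoot n : ℂ) (2 ^ n) := by
  have h := Complex.isPrimitiveRoot_exp (2 ^ n) (by positivity)
  convert h using 1
  rw [dyadicRoot, Circle.coe_exp]
  congr 1; push_cast; ring

theorem dyadicRoot_pow_pow (n a : ℕ) : (dyadicRoot n ^ a) ^ (2 ^ n) = 1 := by
  have h : dyadicRoot n ^ (2 ^ n) = 1 := by
    apply Circle.ext
    rw [Circle.coe_pow, Circle.coe_one]
    exact (isPrimitiveRoot_dyadicRoot n).pow_eq_one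
  rw [← pow_mul, mul_comm, pow_mul, h, one_pow]

/-- Fourier inversion on ℤ/2^n: the eigenfunctions of level n span the indicators of the phases. -/
theorem sum_dyadicRoot_phaseFun {y : ℤ → Bool} (hy : y ∈ subshift) {n j : ℕ} (hj : j < 2 ^ n) :
    (2 ^ n : ℂ)⁻¹ * ∑ a ∈ Finset.range (2 ^ n),
      ((dyadicRoot n : ℂ)⁻¹ ^ j) ^ a * phaseFun n (dyadicRoot n ^ a) y =
      (phaseSet n j).indicator 1 y := by
  obtain ⟨k, hk, hmem⟩ := exists_mem_phaseSet hy n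
  have hω := isPrimitiveRoot_dyadicRoot n
  set ω : ℂ := (dyadicRoot n : ℂ) with hωdef
  have hω0 : ω ≠ 0 := (dyadicRoot n).coe_ne_zero
  have h1 (a : ℕ) : (ω⁻¹ ^ j) ^ a * phaseFun n (dyadicRoot n ^ a) y = (ω⁻¹ ^ j * ω ^ k) ^ a := by
    rw [phaseFun_eq hy (dyadicRoot_pow_pow n a) hmem, zpow_natCast, Circle.coe_pow, mul_pow,
      ← pow_mul ω, ← pow_mul, mul_comm a k, pow_mul ω k a]
  simp only [h1]
  by_cases hjk : j = k
  · subst hjk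
    rw [← mul_pow, inv_mul_cancel₀ hω0, Set.indicator_of_mem hmem]
    simp
  · have h2 : y ∉ phaseSet n j := by
      intro hmem'
      have h3 := sum_indicator_phaseSet hy hj hmem' fun l => l
      rw [sum_indicator_phaseSet hy hk hmem fun l => l] at h3
      exact hjk h3.symm
    have h3 : ω⁻¹ ^ j * ω ^ k ≠ 1 := by
      intro h4
      rw [inv_pow, inv_mul_eq_one₀ (pow_ne_zero _ hω0)] at h4
      exact hjk (hω.pow_inj hj hk h4)
    have h4 : (ω⁻¹ ^ j * ω ^ k) ^ (2 ^ n) = 1 := by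
      rw [mul_pow, ← pow_mul, ← pow_mul, mul_comm j, mul_comm k, pow_mul, pow_mul, inv_pow,
        hω.pow_eq_one]
      simp
    rw [geom_sum_eq h3, h4, sub_self, zero_div, mul_zero, Set.indicator_of_notMem h2]

theorem integrable_phaseFun_mul (h : IsSubshiftMeasure μ) {n : ℕ} {ζ : Circle}
    (hζ : ζ ^ (2 ^ n) = 1) {G : (ℤ → Bool) → ℂ} (hG : Integrable G μ) :
    Integrable (fun y => phaseFun n ζ y * G y) μ := by
  refine hG.bdd_mul (measurable_phaseFun n ζ).aestronglyMeasurable (c := 1) ?_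
  filter_upwards [h.carried] with y hy
  exact (norm_phaseFun hy hζ).le

theorem setIntegral_phaseSet_eq_zero (h : IsSubshiftMeasure μ) {G : (ℤ → Bool) → ℂ}
    (hG : Integrable G μ)
    (h0 : ∀ (n : ℕ) (ζ : Circle), ζ ^ (2 ^ n) = 1 → ∫ y, phaseFun n ζ y * G y ∂μ = 0)
    {n j : ℕ} (hj : j < 2 ^ n) : ∫ y, (phaseSet n j).indicator 1 y * G y ∂μ = 0 := by
  have h1 : ∀ᵐ y ∂μ, (phaseSet n j).indicator 1 y * G y = (2 ^ n : ℂ)⁻¹ *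
      ∑ a ∈ Finset.range (2 ^ n),
        ((dyadicRoot n : ℂ)⁻¹ ^ j) ^ a * (phaseFun n (dyadicRoot n ^ a) y * G y) := by
    filter_upwards [h.carried] with y hy
    rw [← sum_dyadicRoot_phaseFun hy hj, mul_assoc, Finset.sum_mul]
    simp only [mul_assoc]
  rw [integral_congr_ae h1, integral_const_mul, integral_finsetSum _ fun a _ =>
    (integrable_phaseFun_mul h (dyadicRoot_pow_pow n a) hG).const_mul _]
  simp [integral_const_mul, h0 n _ (dyadicRoot_pow_pow n _)]

/-- The block with phase `j` and value `b` at the coordinate `0`. -/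
def blockPoint (j : ℕ) (b : Bool) : ℤ → Bool := fun i => b ^^ seq j ^^ seq (i + j).toNat

/-- The approximation of `f` that only depends on the phase of level `n` and the coordinate `0`. -/
noncomputable def blockApprox (f : (ℤ → Bool) → ℂ) (n : ℕ) (y : ℤ → Bool) : ℂ :=
  ∑ j ∈ Finset.range (2 ^ n), (phaseSet n j).indicator (fun _ => f (blockPoint j (y 0))) y

theorem blockApprox_eq {f : (ℤ → Bool) → ℂ} {n j : ℕ} {y : ℤ → Bool} (hy : y ∈ subshift)
    (hj : j < 2 ^ n) (hmem : y ∈ phaseSet n j) :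
    blockApprox f n y = f (blockPoint j (y 0)) :=
  sum_indicator_phaseSet hy hj hmem fun j => f (blockPoint j (y 0))

/-- A function of the single bit `y 0` is its mean plus half its difference times `coordSign`; this
is why two families of generators suffice. -/
theorem blockApprox_eq_sum (f : (ℤ → Bool) → ℂ) (n : ℕ) (y : ℤ → Bool) :
    blockApprox f n y = ∑ j ∈ Finset.range (2 ^ n),
      (((f (blockPoint j false) + f (blockPoint j true)) / 2) *
          (phaseSet n j).indicator 1 y +
        ((f (blockPoint j false) - f (blockPoint j true)) / 2) *
          ((phaseSet n j).indicator 1 y * coordSign y)) := by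
  refine Finset.sum_congr rfl fun j _ => ?_
  by_cases hy : y ∈ phaseSet n j
  · simp only [Set.indicator_of_mem hy, coordSign, Pi.one_apply]
    cases y 0
    · simp; ring
    · simp; ring
  · simp [Set.indicator_of_notMem hy]

theorem measurable_blockApprox (f : (ℤ → Bool) → ℂ) (n : ℕ) : Measurable (blockApprox f n) := by
  rw [funext (blockApprox_eq_sum f n)]
  have h1 (j : ℕ) : Measurable ((phaseSet n j).indicator (1 : (ℤ → Bool) → ℂ)) :=
    measurable_one.indicator (measurableSet_phaseSet n j)
  exact Finset.measurable_fun_sum _ fun j _ =>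
    ((h1 j).const_mul _).add (((h1 j).mul measurable_coordSign).const_mul _)

theorem integral_blockApprox_mul_eq_zero (h : IsSubshiftMeasure μ) {G : (ℤ → Bool) → ℂ}
    (hG : Integrable G μ)
    (h0 : ∀ (n : ℕ) (ζ : Circle), ζ ^ (2 ^ n) = 1 → ∫ y, phaseFun n ζ y * G y ∂μ = 0)
    (h1 : ∀ (n : ℕ) (ζ : Circle), ζ ^ (2 ^ n) = 1 →
      ∫ y, phaseFun n ζ y * (coordSign y * G y) ∂μ = 0)
    (f : (ℤ → Bool) → ℂ) (n : ℕ) : ∫ y, blockApprox f n y * G y ∂μ = 0 := by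
  have hG' : Integrable (fun y => coordSign y * G y) μ :=
    hG.bdd_mul measurable_coordSign.aestronglyMeasurable (c := 1)
      (Eventually.of_forall fun y => (norm_coordSign y).le)
  have hind {G : (ℤ → Bool) → ℂ} (hG : Integrable G μ) (j : ℕ) :
      Integrable (fun y => (phaseSet n j).indicator 1 y * G y) μ := by
    refine hG.bdd_mul (measurable_one.indicator
      (measurableSet_phaseSet n j)).aestronglyMeasurable (c := 1) (Eventually.of_forall fun y => ?_)
    by_cases hy : y ∈ phaseSet n j <;> simp [hy]
  have hpt (y : ℤ → Bool) : blockApprox f n y * G y = ∑ j ∈ Finset.range (2 ^ n),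
      (((f (blockPoint j false) + f (blockPoint j true)) / 2) *
          ((phaseSet n j).indicator 1 y * G y) +
        ((f (blockPoint j false) - f (blockPoint j true)) / 2) *
          ((phaseSet n j).indicator 1 y * (coordSign y * G y))) := by
    rw [blockApprox_eq_sum, Finset.sum_mul]
    exact Finset.sum_congr rfl fun j _ => by ring
  simp only [hpt]
  have hI (j : ℕ) : Integrable (fun y =>
      ((f (blockPoint j false) + f (blockPoint j true)) / 2) *
          ((phaseSet n j).indicator 1 y * G y) +
        ((f (blockPoint j false) - f (blockPoint j true)) / 2) *
          ((phaseSet n j).indicator 1 y * (coordSign y * G y))) μ :=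
    ((hind hG j).const_mul _).add ((hind hG' j).const_mul _)
  rw [integral_finsetSum _ fun j _ => hI j]
  refine Finset.sum_eq_zero fun j hj => ?_
  rw [Finset.mem_range] at hj
  rw [integral_add ((hind hG j).const_mul _) ((hind hG' j).const_mul _), integral_const_mul,
    integral_const_mul, setIntegral_phaseSet_eq_zero h hG h0 hj,
    setIntegral_phaseSet_eq_zero h hG' h1 hj]
  simp

/-- Once the block around 0 contains i, the block point agrees with y at i. Hence it converges to y
coordinatewise. -/
theorem tendsto_blockApprox {f : (ℤ → Bool) → ℂ} (hf : Continuous f) {y : ℤ → Bool}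
    (hy : y ∈ subshift) (hne : ∀ k : ℤ, ∃ n, y ∉ phaseSet n k) :
    Tendsto (fun n => blockApprox f n y) atTop (𝓝 (f y)) := by
  choose j hj hmem using exists_mem_phaseSet hy
  simp only [fun n => blockApprox_eq (f := f) hy (hj n) (hmem n)]
  refine (hf.tendsto y).comp (tendsto_pi_nhds.2 fun i => ?_)
  choose N hN using hne
  have hN' (k : ℤ) (n : ℕ) (hn : N k ≤ n) : y ∉ phaseSet n k :=
    fun h => hN k (phaseSet_antitone k hn h)
  set M := ∑ k ∈ Finset.Icc (-|i|) |i|, N k with hM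
  have hNM (k : ℤ) (hk : k ∈ Finset.Icc (-|i|) |i|) : N k ≤ M :=
    Finset.single_le_sum (f := N) (fun _ _ => Nat.zero_le _) hk
  refine tendsto_const_nhds.congr' ?_
  filter_upwards [eventually_ge_atTop M] with n hn
  have hjn : (j n : ℤ) < 2 ^ n := by exact_mod_cast hj n
  have hi1 := le_abs_self i
  have hi2 := neg_abs_le i
  refine apply_eq_of_mem_phaseSet (hj n) (hmem n) ?_ ?_
  -- If the block misses i on the left, its phase lies in [0, |i|]; if on the right, the phase minus
  -- 2^n lies in [-|i|, 0). Both ranges are excluded from level M on.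
  · by_contra! hlt
    refine hN' (j n) n ((hNM _ (Finset.mem_Icc.2 ⟨?_, ?_⟩)).trans hn) (hmem n)
    · have := abs_nonneg i
      omega
    · omega
  · by_contra! hlt
    have h1 : y ∈ phaseSet n (j n - 2 ^ n) := by
      have := phaseSet_add_mul n (j n) (-1)
      rw [mul_neg_one, ← sub_eq_add_neg] at this
      rw [this]; exact hmem n
    refine hN' _ n ((hNM _ (Finset.mem_Icc.2 ⟨?_, ?_⟩)).trans hn) h1
    · omega
    · have := abs_nonneg i
      omega

theorem integral_mul_eq_zero_of_orthogonal (h : IsSubshiftMeasure μ) {G : (ℤ → Bool) → ℂ}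
    (hG : Integrable G μ)
    (h0 : ∀ (n : ℕ) (ζ : Circle), ζ ^ (2 ^ n) = 1 → ∫ y, phaseFun n ζ y * G y ∂μ = 0)
    (h1 : ∀ (n : ℕ) (ζ : Circle), ζ ^ (2 ^ n) = 1 →
      ∫ y, phaseFun n ζ y * (coordSign y * G y) ∂μ = 0)
    (f : C(ℤ → Bool, ℂ)) : ∫ y, f y * G y ∂μ = 0 := by
  have hlim : Tendsto (fun n => ∫ y, blockApprox f n y * G y ∂μ) atTop (𝓝 (∫ y, f y * G y ∂μ)) := by
    refine tendsto_integral_of_dominated_convergence (fun y => ‖f‖ * ‖G y‖)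
      (fun n => (measurable_blockApprox f n).aestronglyMeasurable.mul hG.aestronglyMeasurable)
      (hG.norm.const_mul _) (fun n => ?_) ?_
    · filter_upwards [h.carried] with y hy
      obtain ⟨j, hj, hmem⟩ := exists_mem_phaseSet hy n
      rw [blockApprox_eq hy hj hmem, norm_mul]
      gcongr
      exact f.norm_coe_le_norm _
    · filter_upwards [h.carried, h.ae_eventually_notMem_phaseSet] with y hy hne
      exact (tendsto_blockApprox f.continuous hy hne).mul_const _
  simp only [integral_blockApprox_mul_eq_zero h hG h0 h1] at hlim
  exact (tendsto_nhds_unique hlim tendsto_const_nhds)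

/-- The eigenfunctions and their products with the sign of the coordinate `0`, in `L²(μ)`. -/
def generators (h : IsSubshiftMeasure μ) : Set (Lp ℂ 2 μ) :=
  {u | ∃ (n : ℕ) (ζ : Circle) (hζ : ζ ^ (2 ^ n) = 1),
    u = (memLp_phaseFun h hζ).toLp _ ∨ u = (memLp_phaseFun_mul_coordSign h hζ).toLp _}

theorem span_generators_topologicalClosure (h : IsSubshiftMeasure μ) :
    (Submodule.span ℂ (generators h)).topologicalClosure = ⊤ := by
  have := h.prob
  rw [Submodule.topologicalClosure_eq_top_iff, Submodule.eq_bot_iff]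
  intro g hg
  rw [Submodule.mem_orthogonal'] at hg
  set G : (ℤ → Bool) → ℂ := fun y => (starRingEnd ℂ) (g y) with hGdef
  have hgI : Integrable g μ := (Lp.memLp g).integrable (by norm_num)
  have hG : Integrable G μ := by
    have := (Complex.conjCLE : ℂ →L[ℝ] ℂ).integrable_comp hgI
    exact this
  have hinner {F : (ℤ → Bool) → ℂ} (hF : MemLp F 2 μ) :
      inner ℂ g (hF.toLp F) = ∫ y, F y * G y ∂μ := by
    rw [L2.inner_def]
    refine integral_congr_ae ?_
    filter_upwards [hF.coeFn_toLp] with y hy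
    rw [hy, RCLike.inner_apply]
  have hcont (f : C(ℤ → Bool, ℂ)) : ∫ y, f y * G y ∂μ = 0 := by
    refine integral_mul_eq_zero_of_orthogonal h hG (fun n ζ hζ => ?_) (fun n ζ hζ => ?_) f
    · rw [← hinner (memLp_phaseFun h hζ)]
      exact hg _ (Submodule.subset_span ⟨n, ζ, hζ, Or.inl rfl⟩)
    · simp only [← mul_assoc]
      rw [← hinner (memLp_phaseFun_mul_coordSign h hζ)]
      exact hg _ (Submodule.subset_span ⟨n, ζ, hζ, Or.inr rfl⟩)
  have hdense := ContinuousMap.toLp_denseRange (α := ℤ → Bool) ℂ μ ℂ (p := 2) (by norm_num)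
  have hzero : ∀ u : Lp ℂ 2 μ, inner ℂ g u = 0 := by
    intro u
    refine hdense.induction_on (p := fun u => inner ℂ g u = 0) u
      (isClosed_eq (by fun_prop) continuous_const) fun f => ?_
    rw [L2.inner_def, ← hcont f]
    refine integral_congr_ae ?_
    filter_upwards [ContinuousMap.coeFn_toLp (p := 2) (𝕜 := ℂ) μ f] with y hy
    rw [hy, RCLike.inner_apply]
  exact inner_self_eq_zero.1 (hzero g)

end Totality

/-! ### The maximal spectral type -/

section MaximalType

variable {μ : Measure (ℤ → Bool)}

/-- The unitary operator `F ↦ F ∘ T ^ m` of `L²(μ)`. -/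
noncomputable def koopman (h : IsSubshiftMeasure μ) (m : ℤ) : Lp ℂ 2 μ →ₗᵢ[ℂ] Lp ℂ 2 μ :=
  Lp.compMeasurePreservingₗᵢ ℂ (shift m) (h.measurePreserving_shift m)

theorem koopman_add (h : IsSubshiftMeasure μ) (m n : ℤ) (x : Lp ℂ 2 μ) :
    koopman h (m + n) x = koopman h m (koopman h n x) := by
  have h1 : shift (m + n) = shift n ∘ shift m := funext fun y => by
    rw [add_comm, shift_add]; rfl
  have h2 := Lp.compMeasurePreserving_comp_apply x (h.measurePreserving_shift n)
    (h.measurePreserving_shift m)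
  refine Eq.trans ?_ h2
  simp only [koopman, h1]
  rfl

theorem integral_eq_inner_koopman (h : IsSubshiftMeasure μ) {F : (ℤ → Bool) → ℂ}
    (hF : MemLp F 2 μ) {ρ : Measure Circle} (hρ : IsSpectralMeasureOf μ F ρ) (m : ℤ) :
    ∫ z : Circle, (z : ℂ) ^ m ∂ρ = inner ℂ (hF.toLp F) (koopman h m (hF.toLp F)) := by
  rw [hρ.fourier]
  have h1 : koopman h m (hF.toLp F) =
      (hF.comp_measurePreserving (h.measurePreserving_shift m)).toLp _ :=
    Lp.toLp_compMeasurePreserving hF (h.measurePreserving_shift m)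
  rw [h1, L2.inner_def]
  refine integral_congr_ae ?_
  filter_upwards [hF.coeFn_toLp,
    (hF.comp_measurePreserving (h.measurePreserving_shift m)).coeFn_toLp] with y hy hy'
  rw [hy, hy', RCLike.inner_apply]
  rfl

theorem absolutelyContinuous_of_isClosed {ρ τ : Measure Circle} [IsFiniteMeasure ρ]
    (h : ∀ E, IsClosed E → τ E = 0 → ρ E = 0) : ρ ≪ τ := by
  refine Measure.AbsolutelyContinuous.mk fun E hE hτ => ?_
  rw [hE.measure_eq_iSup_isClosed_of_ne_top (measure_ne_top ρ E)]
  simp only [ENNReal.iSup_eq_zero]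
  exact fun K hK hKc => h K hKc (measure_mono_null hK hτ)

/-- The null sets of D + D*σ are the common null sets of the spectral measures of the generators.
Totality yields domination. Minimality holds because those measures are themselves spectral
measures. -/
theorem isMaximalSpectralType_add_mconv (h : IsSubshiftMeasure μ) {σ D : Measure Circle}
    (hσ : IsSpectralMeasureOfSeq σ) (hD : IsDyadicDiscrete D) :
    IsMaximalSpectralType μ (D + Measure.mconv D σ) := by
  have := hσ.finite
  have := hD.finite
  have := isFiniteMeasure_mconv (σ := σ) hD
  refine ⟨inferInstance, ?_, ?_⟩
  · intro F ρ hF hρ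
    have := hρ.finite
    refine absolutelyContinuous_of_isClosed fun E hE hE0 => ?_
    rw [Measure.add_apply, add_eq_zero, hD.measure_eq_zero_iff,
      hD.mconv_apply_eq_zero_iff hE.measurableSet] at hE0
    refine measure_eq_zero_of_total (koopman_add h) (span_generators_topologicalClosure h) hE ?_
      (integral_eq_inner_koopman h hF hρ)
    rintro _ ⟨n, ζ, hζ, rfl | rfl⟩
    · have hs := isSpectralMeasureOf_phaseFun h hζ
      refine ⟨_, hs.finite, integral_eq_inner_koopman h _ hs, ?_⟩
      rw [Measure.dirac_apply' _ hE.measurableSet, Set.indicator_of_notMem (hE0.1 ζ ⟨n, hζ⟩)]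
    · have hs := isSpectralMeasureOf_phaseFun_mul_coordSign h hσ hζ
      refine ⟨_, hs.finite, integral_eq_inner_koopman h _ hs, ?_⟩
      rw [Measure.map_apply (measurable_mul_left_circle ζ) hE.measurableSet]
      exact hE0.2 ζ ⟨n, hζ⟩
  · intro τ' _ hdom
    refine Measure.AbsolutelyContinuous.mk fun E hE hE0 => ?_
    rw [Measure.add_apply, add_eq_zero, hD.measure_eq_zero_iff, hD.mconv_apply_eq_zero_iff hE]
    refine ⟨?_, ?_⟩
    · rintro ζ ⟨n, hζ⟩ hmem
      have h1 := hdom _ _ (memLp_phaseFun h hζ) (isSpectralMeasureOf_phaseFun h hζ) hE0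
      rw [Measure.dirac_apply' _ hE, Set.indicator_of_mem hmem] at h1
      simp at h1
    · rintro ζ ⟨n, hζ⟩
      have h1 := hdom _ _ (memLp_phaseFun_mul_coordSign h hζ)
        (isSpectralMeasureOf_phaseFun_mul_coordSign h hσ hζ) hE0
      rwa [Measure.map_apply (measurable_mul_left_circle ζ) hE] at h1

theorem IsMaximalSpectralType.sameType {τ τ' : Measure Circle} (h : IsMaximalSpectralType μ τ)
    (h' : IsMaximalSpectralType μ τ') : SameType τ τ' :=
  ⟨h.least τ' h'.finite h'.dominates, h'.least τ h.finite h.dominates⟩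

end MaximalType

/-! ### Existence of an invariant measure -/

/-- A two-sided extension of the Thue-Morse sequence. -/
def extendedSeq : ℤ → Bool := fun i => seq i.toNat

/-- The empirical measures of the orbit of the Thue-Morse sequence. -/
noncomputable def empirical (N : ℕ) : Measure (ℤ → Bool) :=
  ((N + 1 : ℕ) : ENNReal)⁻¹ • ∑ n ∈ Finset.range (N + 1), Measure.dirac (shift n extendedSeq)

instance isProbabilityMeasure_empirical (N : ℕ) : IsProbabilityMeasure (empirical N) := by
  refine ⟨?_⟩
  rw [empirical, Measure.smul_apply, Measure.finsetSum_apply]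
  simp only [measure_univ, Finset.sum_const, Finset.card_range, nsmul_eq_mul, mul_one, smul_eq_mul]
  exact ENNReal.inv_mul_cancel (by simp) (by finiteness)

theorem integral_empirical (N : ℕ) (f : C(ℤ → Bool, ℂ)) :
    ∫ y, f y ∂(empirical N) =
      ((N + 1 : ℕ) : ℂ)⁻¹ * ∑ n ∈ Finset.range (N + 1), f (shift n extendedSeq) := by
  rw [empirical, integral_smul_measure, integral_finsetSum_measure fun n _ =>
    integrable_continuousMap _ f]
  simp only [integral_dirac, ENNReal.toReal_inv, ENNReal.toReal_natCast]
  rw [Complex.real_smul]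
  push_cast; rfl

theorem continuous_shift (m : ℤ) : Continuous (shift m) :=
  continuous_pi fun i => continuous_apply (i + m)

theorem norm_integral_empirical_shift_sub_le (N : ℕ) (f : C(ℤ → Bool, ℂ)) :
    ‖∫ y, f (shift 1 y) ∂(empirical N) - ∫ y, f y ∂(empirical N)‖ ≤ 2 * ‖f‖ / (N + 1) := by
  have h1 := integral_empirical N (f.comp ⟨shift 1, continuous_shift 1⟩)
  simp only [ContinuousMap.comp_apply, ContinuousMap.coe_mk, ← shift_add] at h1
  rw [h1, integral_empirical, ← mul_sub, ← Finset.sum_sub_distrib]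
  have h2 := Finset.sum_range_sub (fun n : ℕ => f (shift n extendedSeq)) (N + 1)
  simp only [Nat.cast_add, Nat.cast_one, Nat.cast_zero] at h2
  simp only [add_comm (1 : ℤ)]
  rw [h2, norm_mul, norm_inv, mul_comm, ← div_eq_mul_inv, Complex.norm_natCast]
  push_cast
  gcongr
  refine (norm_sub_le _ _).trans ?_
  linarith [f.norm_coe_le_norm (shift (N + 1) extendedSeq),
    f.norm_coe_le_norm (shift 0 extendedSeq)]

/-- The Krylov-Bogolyubov argument: a weak limit of empirical measures is invariant because shifting
changes the averages by O(1/N). -/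
theorem exists_isSubshiftMeasure : ∃ μ : Measure (ℤ → Bool), IsSubshiftMeasure μ := by
  obtain ⟨μ, hμ⟩ := exists_weak_limit fun N => (⟨empirical N, inferInstance⟩ :
    ProbabilityMeasure (ℤ → Bool))
  simp only [ProbabilityMeasure.coe_mk] at hμ
  have hinv : MeasurePreserving (shift 1) (μ : Measure (ℤ → Bool)) μ := by
    refine ⟨measurable_shift 1, ?_⟩
    have hp : IsProbabilityMeasure ((μ : Measure (ℤ → Bool)).map (shift 1)) :=
      Measure.isProbabilityMeasure_map (measurable_shift 1).aemeasurable
    refine ext_of_forall_integral_eq_of_IsFiniteMeasure fun f => ?_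
    rw [integral_map (measurable_shift 1).aemeasurable f.continuous.aestronglyMeasurable]
    set g : C(ℤ → Bool, ℂ) := ⟨fun y => (f y : ℂ), by fun_prop⟩ with hg
    have h1 := (hμ (g.comp ⟨shift 1, continuous_shift 1⟩)).sub (hμ g)
    have h2 : Tendsto (fun N : ℕ => ∫ y, (g.comp ⟨shift 1, continuous_shift 1⟩) y ∂(empirical N) -
        ∫ y, g y ∂(empirical N)) (hyperfilter ℕ) (𝓝 0) := by
      have h3 : Tendsto (fun N : ℕ => 2 * ‖g‖ / ((N : ℝ) + 1)) atTop (𝓝 0) := by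
        have := tendsto_one_div_add_atTop_nhds_zero_nat.const_mul (2 * ‖g‖)
        simpa [div_eq_mul_inv] using this
      exact squeeze_zero_norm (fun N => norm_integral_empirical_shift_sub_le N g)
        (h3.mono_left Nat.hyperfilter_le_atTop)
    have h4 := sub_eq_zero.1 (tendsto_nhds_unique h1 h2)
    simp only [ContinuousMap.comp_apply, ContinuousMap.coe_mk, hg, integral_complex_ofReal] at h4
    exact_mod_cast h4
  refine ⟨μ, inferInstance, hinv, ?_⟩
  -- Only windows starting at coordinate 0 are tested, so the arbitrary values of `extendedSeq` at
  -- negative coordinates never enter. Invariance then moves the windows.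
  set W : ℕ → Set (ℤ → Bool) := fun n => {y | ∃ j : ℕ, ∀ l < n, y (l : ℤ) = seq (j + l)} with hW
  have hW0 (n : ℕ) : ∀ᵐ y ∂(μ : Measure (ℤ → Bool)), y ∈ W n := by
    have hclopen : IsClopen (W n) := by
      have : W n = (fun y : ℤ → Bool => fun l : Fin n => y (l : ℤ)) ⁻¹'
          {v | ∃ j : ℕ, ∀ l : Fin n, v l = seq (j + l)} := by
        ext y
        constructor
        · rintro ⟨j, hj⟩
          exact ⟨j, fun l => hj l l.2⟩
        · rintro ⟨j, hj⟩
          exact ⟨j, fun l hl => hj ⟨l, hl⟩⟩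
      rw [this]
      exact (isClopen_discrete _).preimage (continuous_pi fun l => continuous_apply _)
    set g : C(ℤ → Bool, ℂ) := ⟨(W n).indicator 1, hclopen.continuous_indicator continuous_one⟩
      with hg
    have h1 := hμ g
    have h2 (N : ℕ) : ∫ y, g y ∂(empirical N) = 1 := by
      rw [integral_empirical]
      have h3 (k : ℕ) : g (shift k extendedSeq) = 1 := by
        refine Set.indicator_of_mem (s := W n) ⟨k, fun l _ => ?_⟩ _
        rw [shift_apply, extendedSeq]
        congr 1; omega
      simp only [h3, Finset.sum_const, Finset.card_range, nsmul_eq_mul, mul_one]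
      exact inv_mul_cancel₀ (by exact_mod_cast Nat.succ_ne_zero N)
    simp only [h2] at h1
    have h3 := tendsto_nhds_unique h1 tendsto_const_nhds
    have h4 : ∫ y, g y ∂(μ : Measure (ℤ → Bool)) = ((μ : Measure (ℤ → Bool)).real (W n) : ℂ) := by
      simp only [hg, ContinuousMap.coe_mk]
      rw [integral_indicator hclopen.isOpen.measurableSet]
      simp
    rw [h4] at h3
    have h5 : (μ : Measure (ℤ → Bool)).real (W n) = 1 := by exact_mod_cast h3
    exact (mem_ae_iff_prob_eq_one hclopen.isOpen.measurableSet).2 (by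
      rw [← ENNReal.toReal_eq_one_iff]; exact h5)
  have hpres (i : ℤ) : Measure.QuasiMeasurePreserving (shift i) (μ : Measure (ℤ → Bool)) μ :=
    (measurePreserving_shift hinv i).quasiMeasurePreserving
  have hall : ∀ᵐ y ∂(μ : Measure (ℤ → Bool)), ∀ (i : ℤ) (n : ℕ), shift i y ∈ W n := by
    rw [ae_all_iff]; intro i
    rw [ae_all_iff]; intro n
    exact (hpres i).ae (hW0 n)
  filter_upwards [hall] with y hy i n
  obtain ⟨j, hj⟩ := hy i n
  exact ⟨j, fun l hl => by rw [← hj l hl, shift_apply, add_comm]⟩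

end ThueMorse

/-! ### Assembly of the main theorem -/

open ThueMorse in
theorem mainTheorem3 :
    -- the spectral measure `σ` of the sequence exists and is unique
    (∃! σ : Measure Circle, ThueMorse.IsSpectralMeasureOfSeq σ) ∧
    -- there is an invariant probability measure on the subshift
    (∃ μ : Measure (ℤ → Bool), ThueMorse.IsSubshiftMeasure μ) ∧
    ∀ σ : Measure Circle, ThueMorse.IsSpectralMeasureOfSeq σ →
      -- the assertions for `σ`
      ((∀ r s : ℕ, 1 ≤ r → 1 ≤ s →
          (Measure.MutuallySingular (ThueMorse.powImage σ r) (ThueMorse.powImage σ s) ↔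
            ¬ ∃ a : ℕ, max ((r : ℚ) / s) ((s : ℚ) / r) = 2 ^ a)) ∧
        (∀ a r : ℕ, ThueMorse.powImage σ r = ThueMorse.powImage σ (2 ^ a * r)) ∧
        (∀ p q : ℕ, Odd p → Odd q → p ≠ q →
          Measure.MutuallySingular (ThueMorse.powImage σ p) (ThueMorse.powImage σ q))) ∧
      ∀ μ : Measure (ℤ → Bool), ThueMorse.IsSubshiftMeasure μ →
        -- the maximal spectral type is `D + D ∗ σ`, with continuous part `D ∗ σ`
        (∀ D : Measure Circle, ThueMorse.IsDyadicDiscrete D →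
          ThueMorse.IsMaximalSpectralType μ (D + Measure.mconv D σ) ∧
          ThueMorse.continuousPart (D + Measure.mconv D σ) = Measure.mconv D σ) ∧
        -- the assertions for the continuous part of the maximal spectral type
        ∀ τ : Measure Circle, ThueMorse.IsMaximalSpectralType μ τ →
          (∀ r s : ℕ, 1 ≤ r → 1 ≤ s →
            (Measure.MutuallySingular (ThueMorse.powImage (ThueMorse.continuousPart τ) r)
                (ThueMorse.powImage (ThueMorse.continuousPart τ) s) ↔
              ¬ ∃ a : ℕ, max ((r : ℚ) / s) ((s : ℚ) / r) = 2 ^ a)) ∧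
          (∀ a r : ℕ, ThueMorse.SameType
            (ThueMorse.powImage (ThueMorse.continuousPart τ) r)
            (ThueMorse.powImage (ThueMorse.continuousPart τ) (2 ^ a * r))) ∧
          (∀ p q : ℕ, Odd p → Odd q → p ≠ q →
            Measure.MutuallySingular (ThueMorse.powImage (ThueMorse.continuousPart τ) p)
              (ThueMorse.powImage (ThueMorse.continuousPart τ) q)) := by
  refine ⟨existsUnique_isSpectralMeasureOfSeq, exists_isSubshiftMeasure, fun σ hσ => ?_⟩
  have hfin := hσ.finite
  have hσ2 : SameType (powImage σ 2) σ := by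
    rw [hσ.powImage_two]; exact SameType.refl σ
  have hodd : ∀ p q : ℕ, Odd p → Odd q → p ≠ q →
      Measure.MutuallySingular (powImage σ p) (powImage σ q) :=
    fun p q hp hq hpq => hσ.mutuallySingular_powImage hp hq hpq
  refine ⟨⟨fun r s hr hs => mutuallySingular_powImage_iff hσ.ne_zero hσ2 hodd hr hs,
    fun a r => (powImage_two_pow_mul hσ.powImage_two a r).symm, hodd⟩, fun μ hμ =>
    ⟨fun D hD => ⟨isMaximalSpectralType_add_mconv hμ hσ hD,
      hD.continuousPart_add_mconv hσ.measure_singleton⟩, fun τ hτ => ?_⟩⟩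
  -- All representatives of the maximal type are equivalent, so one choice of D transfers everything
  -- from D*σ to `continuousPart τ`, but only up to type.
  obtain ⟨D, hD⟩ := exists_isDyadicDiscrete
  have hτD : SameType (continuousPart τ) (Measure.mconv D σ) := by
    have h := (hτ.sameType (isMaximalSpectralType_add_mconv hμ hσ hD)).continuousPart
    rwa [hD.continuousPart_add_mconv hσ.measure_singleton] at h
  have hτ0 : continuousPart τ ≠ 0 := fun h0 =>
    hD.mconv_ne_zero hσ.ne_zero (Measure.absolutelyContinuous_zero_iff.1 (h0 ▸ hτD.2))
  have hτ2 : SameType (powImage (continuousPart τ) 2) (continuousPart τ) :=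
    ((hτD.powImage 2).trans (hD.sameType_powImage_mconv hσ.powImage_two)).trans hτD.symm
  have hτodd : ∀ p q : ℕ, Odd p → Odd q → p ≠ q →
      Measure.MutuallySingular (powImage (continuousPart τ) p)
        (powImage (continuousPart τ) q) := fun p q hp hq hpq =>
    (hτD.powImage p).symm.mutuallySingular (hτD.powImage q).symm
      (hD.mutuallySingular_powImage_mconv hσ.powImage_two (hodd p q hp hq hpq))
  exact ⟨fun r s hr hs => mutuallySingular_powImage_iff hτ0 hτ2 hτodd hr hs,
    sameType_powImage_two_pow hτ2, hτodd⟩
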